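/- **Theorem 3.8.** Let $T>0$, $k\in\mathbb N=\{0,1,2,\dots\}$, $n\in\mathbb N^*=\{1,2,\dots\}$, and let $(\omega_j)_{j\in\mathbb N}$ be a strictly increasing sequence of $[0,+\infty)$ with $\omega_0=0$ having a polynomial asymptotic gap: there exist $\varepsilon>0$, $N_0\in\mathbb N$ and $c>0$ such that $\omega_{j+1}-\omega_j\ge c\,j^{\varepsilon}$ for all $j\ge N_0$. For $j<0$ put $\omega_j:=-\omega_{-j}$. Let $h^{2k}_{\omega,r}(\mathbb N,\mathbb C)$ be the real vector space of all $(d_j)_{j\in\mathbb N}\in\ell^2(\mathbb N,\mathbb C)$ with $d_0\in\mathbb R$ and $$\|d\|_{h^{2k}_\omega}^2:=\sum_{j=0}^{\infty}\bigl|(\delta_{j,0}+\omega_j^{k})d_j\bigr|^2<\infty ,$$ with this norm (here $\omega_0^0=1$). Let $H^k_0((0,T),\mathbb R)$ be the closure of $C_c^\infty((0,T),\mathbb R)$ in the real Sobolev space $H^k((0,T),\mathbb R)$, with its topology, and for $0\le m\le k$ and $u\in H^k_0((0,T),\mathbb R)$ let $\|u\|_{H^m_0(0,T)}:=\bigl(\int_0^T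 u^{(m)}(t)^2\,dt\bigr)^{1/2}$. Then there exist a constant $C>0$ and a continuous ($\mathbb R$-)linear map $$\mathcal L^T_k:\ \mathbb R^n\times h^{2k}_{\omega,r}(\mathbb N,\mathbb C)\longrightarrow H^k_0((0,T),\mathbb R)$$ such that for every $d=\bigl((d_{-q})_{q=1,\dots,n},(d_j)_{j\in\mathbb N}\bigr)\in\mathbb R^n\times h^{2k}_{\omega,r}(\mathbb N,\mathbb C)$ the function $u:=\mathcal L^T_k(d)$ satisfies $$\int_0^T u(t)e^{i\omega_jt}\,dt=d_j\quad\text{for all } j\in\mathbb N,\qquad \int_0^T t^q u(t)\,dt=d_{-q}\quad\text{for all } q=1,\dots,n,$$ and $$\|u\|_{H^m_0(0,T)}\le C\Bigl(\sum_{j=-n}^{+\infty}\bigl|(\delta_{j,0}+\omega_j^{m})d_j\bigr|^2\Bigr)^{1/2}\quad\text{for all } m=0,\dots,k .$$ -/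

import Mathlib

open MeasureTheory Set
open scoped ENNReal

noncomputable section

namespace TrigMoment

/-! ### Frequencies and sequence spaces -/

/-- Polynomial asymptotic gap: there are `ε > 0`, `N₀` and `c > 0` with
`ω (j+1) - ω j ≥ c * j ^ ε` for all `j ≥ N₀`. -/
def AsymptGapPoly (ω : ℕ → ℝ) : Prop :=
  ∃ ε : ℝ, 0 < ε ∧ ∃ N₀ : ℕ, ∃ c : ℝ, 0 < c ∧
    ∀ j : ℕ, N₀ ≤ j → c * (j : ℝ) ^ ε ≤ ω (j + 1) - ω j

/-- The extension of the frequencies to `ℤ` by `ω_j = - ω_{-j}` for `j < 0`. -/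
def freq (ω : ℕ → ℝ) (j : ℤ) : ℝ :=
  if 0 ≤ j then ω j.toNat else - ω (-j).toNat

/-- The weight `δ_{j,0} + ω_j ^ m`, for `j ∈ ℤ`. -/
def weight (ω : ℕ → ℝ) (m : ℕ) (j : ℤ) : ℝ :=
  (if j = 0 then 1 else 0) + freq ω j ^ m

/-- The weighted sequence `((δ_{j,0} + ω_j ^ m) d_j)_{j ∈ ℕ}`. -/
def weighted (ω : ℕ → ℝ) (m : ℕ) (d : ℕ → ℂ) : ℕ → ℂ :=
  fun j => ((weight ω m (j : ℤ) : ℝ) : ℂ) * d j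

theorem weighted_add (ω : ℕ → ℝ) (m : ℕ) (d e : ℕ → ℂ) :
    weighted ω m (d + e) = weighted ω m d + weighted ω m e := by
  funext j; simp [weighted, mul_add]

theorem weighted_smul (ω : ℕ → ℝ) (m : ℕ) (c : ℝ) (d : ℕ → ℂ) :
    weighted ω m (c • d) = c • weighted ω m d := by
  funext j; simp [weighted]; ring

theorem weighted_zero (ω : ℕ → ℝ) (m : ℕ) : weighted ω m 0 = 0 := by
  funext j; simp [weighted]

/-- The real vector space underlying `h^{2m}_{ω,r}(ℕ, ℂ)`: the sequences `d ∈ ℓ²(ℕ, ℂ)` with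
`d 0` real and `∑ |(δ_{j,0} + ω_j ^ m) d_j|² < ∞`. -/
def hSubmodule (ω : ℕ → ℝ) (m : ℕ) : Submodule ℝ (ℕ → ℂ) where
  carrier := {d | Memℓp d 2 ∧ (d 0).im = 0 ∧ Memℓp (weighted ω m d) 2}
  add_mem' := by
    rintro d e ⟨h1, h2, h3⟩ ⟨g1, g2, g3⟩
    refine ⟨h1.add g1, by simp [h2, g2], ?_⟩
    rw [weighted_add]
    exact h3.add g3
  zero_mem' := by
    refine ⟨zero_memℓp, by simp, ?_⟩
    rw [weighted_zero]
    exact zero_memℓp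
  smul_mem' := by
    rintro c d ⟨h1, h2, h3⟩
    refine ⟨h1.const_smul c, by simp [h2], ?_⟩
    rw [weighted_smul]
    exact h3.const_smul c

/-- The space `h^{2m}_{ω,r}(ℕ, ℂ)`. It is a type of its own, because it does not carry the topology
of pointwise convergence, but that of the norm below. -/
def HSeq (ω : ℕ → ℝ) (m : ℕ) : Type := hSubmodule ω m

instance (ω : ℕ → ℝ) (m : ℕ) : AddCommGroup (HSeq ω m) :=
  inferInstanceAs (AddCommGroup (hSubmodule ω m))

instance (ω : ℕ → ℝ) (m : ℕ) : Module ℝ (HSeq ω m) :=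
  inferInstanceAs (Module ℝ (hSubmodule ω m))

/-- The terms `d j` of an element `d` of `h^{2m}_{ω,r}(ℕ, ℂ)`. -/
def HSeq.term {ω : ℕ → ℝ} {m : ℕ} (d : HSeq ω m) : ℕ → ℂ := d.1

/-- The linear map `d ↦ ((δ_{j,0} + ω_j ^ m) d_j)_j` from `h^{2m}_{ω,r}` to `ℓ²(ℕ, ℂ)`. -/
def HSeq.toLp (ω : ℕ → ℝ) (m : ℕ) : HSeq ω m →ₗ[ℝ] lp (fun _ : ℕ => ℂ) 2 where
  toFun d := ⟨weighted ω m d.term, d.2.2.2⟩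
  map_add' d e := Subtype.ext (weighted_add ω m d.1 e.1)
  map_smul' c d := Subtype.ext (weighted_smul ω m c d.1)

/-- `‖d‖ = (∑ |(δ_{j,0} + ω_j ^ m) d_j|²)^{1/2}`. (This separates points as soon as `ω j ≠ 0` for
all `j ≥ 1`.) -/
instance (ω : ℕ → ℝ) (m : ℕ) : SeminormedAddCommGroup (HSeq ω m) :=
  SeminormedAddCommGroup.induced (HSeq ω m) (lp (fun _ : ℕ => ℂ) 2) (HSeq.toLp ω m)

instance (ω : ℕ → ℝ) (m : ℕ) : NormedSpace ℝ (HSeq ω m) :=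
  NormedSpace.induced ℝ (HSeq ω m) (lp (fun _ : ℕ => ℂ) 2) (HSeq.toLp ω m)

/-- For data `a = (d_{-q})_{q = 1, …, n}` (stored as `a i = d_{-(i+1)}`) and `d = (d_j)_{j ∈ ℕ}`,
the quantity `(∑_{j ≥ -n} |(δ_{j,0} + ω_j ^ m) d_j|²)^{1/2}`. -/
def dataNorm (ω : ℕ → ℝ) (m : ℕ) {n : ℕ} (a : EuclideanSpace ℝ (Fin n)) (d : ℕ → ℂ) : ℝ :=
  Real.sqrt (∑ i : Fin n, |weight ω m (-(((i : ℕ) : ℤ) + 1)) * a i| ^ 2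
    + ∑' j : ℕ, ‖weighted ω m d j‖ ^ 2)

/-! ### Sobolev spaces on `(0, T)` -/

/-- `L²((0,T), ℝ)`. -/
abbrev L2 (T : ℝ) : Type := Lp ℝ 2 (volume.restrict (Ioo (0 : ℝ) T))

/-- `φ ∈ C_c^∞((0,T), ℝ)`. -/
structure IsTest (T : ℝ) (φ : ℝ → ℝ) : Prop where
  smooth : ContDiff ℝ ((⊤ : ℕ∞) : WithTop ℕ∞) φ
  compact : HasCompactSupport φ
  support : tsupport φ ⊆ Ioo 0 T

/-- `v` is the `m`-th weak derivative of `u` on `(0,T)`. -/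
def IsWeakDeriv (T : ℝ) (m : ℕ) (u v : L2 T) : Prop :=
  ∀ φ : ℝ → ℝ, IsTest T φ →
    ∫ t in Ioo 0 T, u t * iteratedDeriv m φ t = (-1) ^ m * ∫ t in Ioo 0 T, v t * φ t

theorem continuous_iteratedDeriv_test {T : ℝ} {φ : ℝ → ℝ} (hφ : IsTest T φ) (m : ℕ) :
    Continuous (iteratedDeriv m φ) :=
  hφ.smooth.continuous_iteratedDeriv m (by exact_mod_cast le_top)

theorem hasCompactSupport_iteratedDeriv {φ : ℝ → ℝ} (hφ : HasCompactSupport φ) (m : ℕ) :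
    HasCompactSupport (iteratedDeriv m φ) := by
  induction m with
  | zero => simpa using hφ
  | succ m ih => rw [iteratedDeriv_succ]; exact ih.deriv

theorem integrable_mul_test {T : ℝ} (u : L2 T) {φ : ℝ → ℝ} (hφ : IsTest T φ) (m : ℕ) :
    Integrable (fun t => u t * iteratedDeriv m φ t) (volume.restrict (Ioo 0 T)) :=
  MemLp.integrable_mul (p := 2) (q := 2) (Lp.memLp u)
    ((continuous_iteratedDeriv_test hφ m).memLp_of_hasCompactSupport
      (hasCompactSupport_iteratedDeriv hφ.compact m))

theorem integral_add_mul_test {T : ℝ} (u v : L2 T) {φ : ℝ → ℝ} (hφ : IsTest T φ) (m : ℕ) :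
    ∫ t in Ioo 0 T, (u + v : L2 T) t * iteratedDeriv m φ t
      = (∫ t in Ioo 0 T, u t * iteratedDeriv m φ t)
        + ∫ t in Ioo 0 T, v t * iteratedDeriv m φ t := by
  rw [← integral_add (integrable_mul_test u hφ m) (integrable_mul_test v hφ m)]
  refine integral_congr_ae ?_
  filter_upwards [Lp.coeFn_add u v] with t ht
  rw [ht, Pi.add_apply, add_mul]

theorem integral_smul_mul_test {T : ℝ} (c : ℝ) (u : L2 T) (ψ : ℝ → ℝ) :
    ∫ t in Ioo 0 T, (c • u : L2 T) t * ψ t = c * ∫ t in Ioo 0 T, u t * ψ t := by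
  rw [← integral_const_mul]
  refine integral_congr_ae ?_
  filter_upwards [Lp.coeFn_smul c u] with t ht
  rw [ht, Pi.smul_apply, smul_eq_mul, mul_assoc]

theorem integral_zero_mul_test {T : ℝ} (ψ : ℝ → ℝ) :
    ∫ t in Ioo 0 T, (0 : L2 T) t * ψ t = 0 := by
  simpa using integral_smul_mul_test (T := T) 0 0 ψ

/-- The Sobolev space `H^k((0,T), ℝ)`, an element being stored as the tuple `(u, u', …, u^{(k)})` of
a function `u ∈ L²(0,T)` and its weak derivatives, which are in `L²(0,T)` and are determined by `u`.
The norm is the usual one, `(∑_{m ≤ k} ‖u^{(m)}‖²_{L²})^{1/2}`. -/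
def sobolev (T : ℝ) (k : ℕ) : Submodule ℝ (PiLp 2 (fun _ : Fin (k + 1) => L2 T)) where
  carrier := {U | ∀ m : Fin (k + 1), IsWeakDeriv T m (U 0) (U m)}
  add_mem' := by
    intro U V hU hV m φ hφ
    have h0 := integral_add_mul_test (U m) (V m) hφ 0
    simp only [iteratedDeriv_zero] at h0
    simp only [PiLp.add_apply]
    rw [h0, integral_add_mul_test (U 0) (V 0) hφ, hU m φ hφ, hV m φ hφ, mul_add]
  zero_mem' := by
    intro m φ _
    simp only [PiLp.zero_apply]
    rw [integral_zero_mul_test, integral_zero_mul_test, mul_zero]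
  smul_mem' := by
    intro c U hU m φ hφ
    simp only [PiLp.smul_apply]
    rw [integral_smul_mul_test, integral_smul_mul_test, hU m φ hφ]
    ring

/-- The subspace `C_c^∞(0,T)` of `H^k(0,T)`. -/
def testSubmodule (T : ℝ) (k : ℕ) : Submodule ℝ (sobolev T k) where
  carrier := {U | ∃ φ : ℝ → ℝ, IsTest T φ ∧ U.1 0 =ᵐ[volume.restrict (Ioo 0 T)] φ}
  add_mem' := by
    rintro U V ⟨φ, hφ, hU⟩ ⟨ψ, hψ, hV⟩
    refine ⟨φ + ψ, ⟨hφ.smooth.add hψ.smooth, hφ.compact.add hψ.compact,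
      (tsupport_add φ ψ).trans (union_subset hφ.support hψ.support)⟩, ?_⟩
    exact (Lp.coeFn_add (U.1 0) (V.1 0)).trans (hU.add hV)
  zero_mem' := by
    refine ⟨0, ⟨contDiff_const, HasCompactSupport.zero, by simp⟩, ?_⟩
    exact Lp.coeFn_zero ℝ 2 _
  smul_mem' := by
    rintro c U ⟨φ, hφ, hU⟩
    refine ⟨c • φ, ⟨hφ.smooth.const_smul c, hφ.compact.smul_left (f := fun _ => c),
      (tsupport_smul_subset_right (fun _ => c) φ).trans hφ.support⟩, ?_⟩
    exact (Lp.coeFn_smul c (U.1 0)).trans (hU.const_smul c)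

/-- `H^k_0((0,T), ℝ)`, the closure of `C_c^∞(0,T)` in `H^k(0,T)`, with the topology of
`H^k(0,T)`. -/
def sobolevZero (T : ℝ) (k : ℕ) : Submodule ℝ (sobolev T k) :=
  (testSubmodule T k).topologicalClosure

/-- The `m`-th weak derivative `u^{(m)} ∈ L²(0,T)` of `u ∈ H^k_0(0,T)`, for `0 ≤ m ≤ k`. -/
def wderiv {T : ℝ} {k : ℕ} (u : sobolevZero T k) (m : Fin (k + 1)) : L2 T := u.1.1 m

/-- The function `u ∈ L²(0,T)` underlying an element of `H^k_0(0,T)`. -/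
def toFn {T : ℝ} {k : ℕ} (u : sobolevZero T k) : L2 T := wderiv u 0

/-- `‖u‖_{H^m_0(0,T)} = (∫₀ᵀ u^{(m)}(t)² dt)^{1/2}`, for `u ∈ H^k_0(0,T)` and `0 ≤ m ≤ k`. -/
def normZero {T : ℝ} {k : ℕ} (m : Fin (k + 1)) (u : sobolevZero T k) : ℝ :=
  Real.sqrt (∫ t in Ioo 0 T, wderiv u m t ^ 2)

end TrigMoment

end

/-! The problem splits at an index N. The gaps tend to infinity, so for any γ the tail λ_j = ω_{N+j}
can be chosen with gaps at least γ and at distance at least γ(j+1) from each of the finitely many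
lower frequencies (`exists_gapSeq`).

On the tail, seek u(t) = ρ(t) Re ∑ λ_j^{-k} x_j e^{-iλ_j t} with a fixed bump ρ of integral 2. Its
moment at λ_l is λ_l^{-k} (x + E_k x)_l, where the entries of E_m are (λ_l/λ_j)^m times half of
ρ̂(λ_l - λ_j), for j ≠ l, plus half of ρ̂(λ_l + λ_j) composed with conjugation. The decay of ρ̂
absorbs the weight and leaves O(γ⁻² (1+|l-j|)⁻²). By Schur's test ‖E_m‖ ≤ 1/2 for all m ≤ k once γ
is large, and x + E_k x = b is solved by a Neumann series. Multiplying this equation by λ_l^{m-k}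
gives y + E_m y = g, hence ‖y‖ ≤ 2‖g‖. With a Bessel inequality for each derivative
(`exists_modul_bound`), the same solution satisfies the estimates of all orders m
(`exists_gap_solver`).

The remaining conditions are finite in number. For a low frequency μ, subtract from a wave at μ the
solution having the same moments on the tail. That solution is small when γ is large, so the moment
at μ survives (`exists_separating_L2`). A convolution makes the difference smooth, and differential
operators impose further zeros and power moments. The resulting test functions are biorthogonal to
the low frequency and power moments and orthogonal to the tail (`exists_low_tests`), so they correct
the tail solution without disturbing it. Their coefficients are bounded by single data and the L²
norm of the tail solution, hence by the data norm of every order m. -/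

noncomputable section

namespace TrigMoment

/-! ### Fourier transforms of smooth compactly supported functions -/

/-- The Fourier transform `x ↦ ∫ f(t) e^{ixt} dt`. -/
def FT (f : ℝ → ℂ) (x : ℝ) : ℂ := ∫ t, f t * Complex.exp (Complex.I * x * t)

/-- `φ` is smooth with compact support in `(0,T)`, complex valued. -/
structure IsCTest (T : ℝ) (φ : ℝ → ℂ) : Prop where
  smooth : ContDiff ℝ ((⊤ : ℕ∞) : WithTop ℕ∞) φ
  compact : HasCompactSupport φ
  support : tsupport φ ⊆ Ioo 0 T

theorem contDiff_deriv {E : Type*} [NormedAddCommGroup E] [NormedSpace ℝ E] {h : ℝ → E}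
    (hs : ContDiff ℝ ((⊤ : ℕ∞) : WithTop ℕ∞) h) :
    ContDiff ℝ ((⊤ : ℕ∞) : WithTop ℕ∞) (deriv h) :=
  (contDiff_infty_iff_deriv.1 hs).2

theorem IsCTest.deriv {T : ℝ} {φ : ℝ → ℂ} (h : IsCTest T φ) : IsCTest T (deriv φ) :=
  ⟨contDiff_deriv h.smooth, h.compact.deriv,
    (closure_minimal (support_deriv_subset) (isClosed_tsupport φ)).trans h.support⟩

theorem IsTest.deriv {T : ℝ} {φ : ℝ → ℝ} (h : IsTest T φ) : IsTest T (deriv φ) :=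
  ⟨contDiff_deriv h.smooth, h.compact.deriv,
    (closure_minimal (support_deriv_subset) (isClosed_tsupport φ)).trans h.support⟩

theorem IsCTest.add {T : ℝ} {φ ψ : ℝ → ℂ} (h : IsCTest T φ) (g : IsCTest T ψ) :
    IsCTest T (φ + ψ) :=
  ⟨h.smooth.add g.smooth, h.compact.add g.compact,
    (tsupport_add φ ψ).trans (union_subset h.support g.support)⟩

theorem IsCTest.smul {T : ℝ} {φ : ℝ → ℂ} (c : ℂ) (h : IsCTest T φ) :
    IsCTest T (c • φ) :=
  ⟨h.smooth.const_smul c, h.compact.smul_left (f := fun _ => c),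
      (tsupport_smul_subset_right (fun _ => c) φ).trans h.support⟩

theorem IsCTest.re {T : ℝ} {φ : ℝ → ℂ} (h : IsCTest T φ) : IsTest T (fun t => (φ t).re) := by
  have hsub : tsupport (fun t => (φ t).re) ⊆ tsupport φ :=
    closure_mono fun t ht => by
      simp only [Function.mem_support] at ht ⊢
      intro h0
      exact ht (by rw [h0]; rfl)
  exact ⟨Complex.reCLM.contDiff.comp h.smooth,
    h.compact.mono' (subset_closure.trans hsub), hsub.trans h.support⟩

theorem IsTest.ofReal {T : ℝ} {φ : ℝ → ℝ} (h : IsTest T φ) :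
    IsCTest T (fun t => (φ t : ℂ)) := by
  have hsub : tsupport (fun t => (φ t : ℂ)) ⊆ tsupport φ :=
    closure_mono fun t ht => by
      simp only [Function.mem_support] at ht ⊢
      intro h0
      exact ht (by rw [h0]; rfl)
  exact ⟨Complex.ofRealCLM.contDiff.comp h.smooth,
    h.compact.mono' (subset_closure.trans hsub), hsub.trans h.support⟩

theorem integral_deriv_mul {h ψ ψ' : ℝ → ℂ} (hs : ContDiff ℝ ((⊤ : ℕ∞) : WithTop ℕ∞) h)
    (hc : HasCompactSupport h) (hψ : ∀ t, HasDerivAt ψ (ψ' t) t) (hψ' : Continuous ψ') :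
    ∫ t, deriv h t * ψ t = - ∫ t, h t * ψ' t := by
  have hψc : Continuous ψ := continuous_iff_continuousAt.2 fun t => (hψ t).continuousAt
  have hd : ContDiff ℝ ((⊤ : ℕ∞) : WithTop ℕ∞) (deriv h) := contDiff_deriv hs
  have key := integral_mul_deriv_eq_deriv_mul_of_integrable (u := h) (u' := deriv h) (v := ψ)
    (v' := ψ') (fun t _ => ((hs.differentiable (by simp)) t).hasDerivAt) (fun t _ => hψ t)
    ((hs.continuous.mul hψ').integrable_of_hasCompactSupport hc.mul_right)
    ((hd.continuous.mul hψc).integrable_of_hasCompactSupport hc.deriv.mul_right)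
    ((hs.continuous.mul hψc).integrable_of_hasCompactSupport hc.mul_right)
  rw [key, neg_neg]

theorem hasDerivAt_expI (x t : ℝ) :
    HasDerivAt (fun t : ℝ => Complex.exp (Complex.I * x * t))
      (Complex.I * x * Complex.exp (Complex.I * x * t)) t := by
  have h1 : HasDerivAt (fun t : ℝ => (t : ℂ)) 1 t := Complex.ofRealCLM.hasDerivAt
  have h2 := (h1.const_mul (Complex.I * x)).cexp
  convert h2 using 1
  ring

theorem norm_expI (x t : ℝ) : ‖Complex.exp (Complex.I * x * t)‖ = 1 := by
  rw [show Complex.I * x * t = ((x * t : ℝ) : ℂ) * Complex.I by push_cast; ring,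
    Complex.norm_exp_ofReal_mul_I]

theorem continuous_expI (x : ℝ) : Continuous (fun t : ℝ => Complex.exp (Complex.I * x * t)) := by
  fun_prop

theorem contDiff_expI (x : ℝ) : ContDiff ℝ ((⊤ : ℕ∞) : WithTop ℕ∞)
    (fun t : ℝ => Complex.exp (Complex.I * x * t)) :=
  (contDiff_const.mul Complex.ofRealCLM.contDiff).cexp

theorem FT_deriv {h : ℝ → ℂ} (hs : ContDiff ℝ ((⊤ : ℕ∞) : WithTop ℕ∞) h)
    (hc : HasCompactSupport h) (x : ℝ) : FT (deriv h) x = - (Complex.I * x) * FT h x := by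
  unfold FT
  rw [integral_deriv_mul hs hc (hasDerivAt_expI x) (by fun_prop), neg_mul, ← integral_const_mul]
  congr 1
  refine integral_congr_ae (ae_of_all _ fun t => ?_)
  ring

theorem integral_deriv_mul_pow {h : ℝ → ℂ} (hs : ContDiff ℝ ((⊤ : ℕ∞) : WithTop ℕ∞) h)
    (hc : HasCompactSupport h) (q : ℕ) :
    ∫ t, deriv h t * (t : ℂ) ^ q = - (q * ∫ t, h t * (t : ℂ) ^ (q - 1)) := by
  have hd : ∀ t : ℝ, HasDerivAt (fun t : ℝ => (t : ℂ) ^ q) ((q : ℂ) * (t : ℂ) ^ (q - 1)) t := by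
    intro t
    have h1 : HasDerivAt (fun t : ℝ => (t : ℂ)) 1 t := Complex.ofRealCLM.hasDerivAt
    have h2 := h1.pow q
    rw [mul_one] at h2
    exact h2
  rw [integral_deriv_mul hs hc hd (by fun_prop), ← integral_const_mul]
  congr 1
  refine integral_congr_ae (ae_of_all _ fun t => ?_)
  ring

theorem norm_FT_le (h : ℝ → ℂ) (x : ℝ) : ‖FT h x‖ ≤ ∫ t, ‖h t‖ := by
  refine (norm_integral_le_integral_norm _).trans (le_of_eq ?_)
  simp [norm_expI]

theorem abs_pow_mul_FT_le (r : ℕ) : ∀ {h : ℝ → ℂ}, ContDiff ℝ ((⊤ : ℕ∞) : WithTop ℕ∞) h →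
    HasCompactSupport h → ∃ A : ℝ, ∀ x : ℝ, |x| ^ r * ‖FT h x‖ ≤ A := by
  induction r with
  | zero => intro h _ _; exact ⟨_, fun x => by simpa using norm_FT_le h x⟩
  | succ r ih =>
    intro h hs hc
    obtain ⟨A, hA⟩ := ih (contDiff_deriv hs) hc.deriv
    refine ⟨A, fun x => le_trans (le_of_eq ?_) (hA x)⟩
    rw [FT_deriv hs hc]
    simp [pow_succ, mul_assoc]

/-- The Fourier transform of a smooth compactly supported function decays rapidly. -/
theorem exists_FT_decay {h : ℝ → ℂ} (hs : ContDiff ℝ ((⊤ : ℕ∞) : WithTop ℕ∞) h)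
    (hc : HasCompactSupport h) (r : ℕ) :
    ∃ A : ℝ, 0 < A ∧ ∀ x : ℝ, (1 + |x|) ^ r * ‖FT h x‖ ≤ A := by
  obtain ⟨A, hA⟩ := abs_pow_mul_FT_le r hs hc
  obtain ⟨B, hB⟩ := abs_pow_mul_FT_le 0 hs hc
  -- The maximum with 1 only makes the constant positive; the other term comes from (1 + |x|)^r ≤
  -- 2^(r-1) (1 + |x|^r).
  refine ⟨max 1 (2 ^ (r - 1) * (B + A)), by positivity, fun x => le_max_of_le_right ?_⟩
  have h1 := add_pow_le zero_le_one (abs_nonneg x) r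
  have h2 := hB x
  calc (1 + |x|) ^ r * ‖FT h x‖ ≤ (2 ^ (r - 1) * (1 ^ r + |x| ^ r)) * ‖FT h x‖ := by gcongr
    _ = 2 ^ (r - 1) * (|x| ^ 0 * ‖FT h x‖ + |x| ^ r * ‖FT h x‖) := by simp; ring
    _ ≤ _ := by gcongr; exact hA x

/-- There is a nonnegative test function on `(0,T)` of integral `2`. -/
theorem exists_test_integral_two {T : ℝ} (hT : 0 < T) : ∃ ρ : ℝ → ℝ, IsTest T ρ ∧
    FT (fun t => (ρ t : ℂ)) 0 = 2 := by
  -- The integral 2 compensates the factor in Re z = (z + z̄)/2, so that the Gram matrix has leading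
  -- diagonal term 1.
  let f : ContDiffBump (T / 2) := ⟨T / 8, T / 4, by positivity, by linarith⟩
  refine ⟨fun t => 2 * f.normed volume t, ⟨?_, ?_, ?_⟩, ?_⟩
  · exact contDiff_const.mul f.contDiff_normed
  · exact (f.hasCompactSupport_normed).mul_left
  · refine (tsupport_mul_subset_right).trans ?_
    rw [f.tsupport_normed_eq, Real.closedBall_eq_Icc]
    exact Icc_subset_Ioo (by show 0 < T / 2 - T / 4; linarith)
      (by show T / 2 + T / 4 < T; linarith)
  · have : ∫ t, 2 * f.normed volume t = 2 := by
      rw [integral_const_mul, f.integral_normed, mul_one]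
    simp only [FT, Complex.ofReal_zero, mul_zero, zero_mul, Complex.exp_zero, mul_one]
    rw [integral_complex_ofReal, this]
    norm_num

/-! ### A Schur test on `ℓ²` -/

/-- The space `ℓ²(ℕ, ℂ)`. -/
abbrev SeqTwo : Type := lp (fun _ : ℕ => ℂ) 2

theorem memℓp_two_iff {x : ℕ → ℂ} : Memℓp x 2 ↔ Summable fun j => ‖x j‖ ^ 2 := by
  rw [memℓp_gen_iff (by simp)]
  simp

theorem SeqTwo.summable (x : SeqTwo) : Summable fun j => ‖x j‖ ^ 2 :=
  memℓp_two_iff.1 x.2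

theorem SeqTwo.norm_sq (x : SeqTwo) : ‖x‖ ^ 2 = ∑' j, ‖x j‖ ^ 2 := by
  simpa using lp.norm_rpow_eq_tsum (p := 2) (by simp) x

theorem SeqTwo.norm_eq (x : SeqTwo) : ‖x‖ = Real.sqrt (∑' j, ‖x j‖ ^ 2) := by
  rw [← SeqTwo.norm_sq, Real.sqrt_sq (norm_nonneg _)]

theorem SeqTwo.norm_apply_le (x : SeqTwo) (j : ℕ) : ‖x j‖ ≤ ‖x‖ :=
  lp.norm_apply_le_norm (by simp) x j

/-- The summable kernel `(1 + |i|)⁻²` on `ℤ`. -/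
def decay (i : ℤ) : ℝ := 1 / (1 + |(i : ℝ)|) ^ 2

theorem decay_pos (i : ℤ) : 0 < decay i := by unfold decay; positivity

theorem summable_decay : Summable decay := by
  have h : Summable fun n : ℕ => 1 / (1 + (n : ℝ)) ^ 2 := by
    have := (summable_nat_add_iff 1).2 (Real.summable_one_div_nat_pow.2 (by norm_num : 1 < 2))
    refine this.congr fun n => ?_
    push_cast
    rw [add_comm]
  refine Summable.of_nat_of_neg ?_ ?_ <;> simpa [decay] using h

/-- The sum of the kernel `decay`. -/
def decaySum : ℝ := ∑' i, decay i

theorem decaySum_pos : 0 < decaySum :=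
  summable_decay.tsum_pos (fun i => (decay_pos i).le) 0 (decay_pos 0)

theorem summable_decay_sub (l : ℕ) : Summable fun j : ℕ => decay (l - j) :=
  summable_decay.comp_injective (i := fun j : ℕ => (l : ℤ) - j) fun a b h => by
    simpa using h

theorem sum_decay_sub_le (l : ℕ) (s : Finset ℕ) : ∑ j ∈ s, decay (l - j) ≤ decaySum := by
  have inj : Function.Injective fun j : ℕ => (l : ℤ) - j := fun a b h => by simpa using h
  have := summable_decay.sum_le_tsum (s.map ⟨_, inj⟩) (fun i _ => (decay_pos i).le)
  simpa [Finset.sum_map, decaySum] using this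

theorem sum_decay_sub_le' (j : ℕ) (t : Finset ℕ) : ∑ l ∈ t, decay (l - j) ≤ decaySum := by
  refine le_trans (Finset.sum_le_sum fun l _ => le_of_eq ?_) (sum_decay_sub_le j t)
  unfold decay
  congr 3
  push_cast
  exact abs_sub_comm _ _

/-- Schur's test for the kernel `decay`, finite version. -/
theorem schur_finite (s t : Finset ℕ) (x : ℕ → ℝ) :
    ∑ l ∈ t, (∑ j ∈ s, decay (l - j) * x j) ^ 2 ≤ decaySum ^ 2 * ∑ j ∈ s, x j ^ 2 := by
  calc ∑ l ∈ t, (∑ j ∈ s, decay (l - j) * x j) ^ 2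
      ≤ ∑ l ∈ t, decaySum * ∑ j ∈ s, decay (l - j) * x j ^ 2 := by
        refine Finset.sum_le_sum fun l _ => ?_
        -- Cauchy–Schwarz with the kernel split as a product of square roots: (∑ k x)² ≤ (∑ k)(∑ k
        -- x²).
        refine (Finset.sum_sq_le_sum_mul_sum_of_sq_le_mul s (fun j _ => (decay_pos (l - j)).le)
          (fun j _ => mul_nonneg (decay_pos (l - j)).le (sq_nonneg (x j)))
          (fun j _ => (by ring_nf; rfl))).trans ?_
        gcongr
        · exact Finset.sum_nonneg fun j _ => mul_nonneg (decay_pos _).le (sq_nonneg _)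
        · exact sum_decay_sub_le l s
    _ = decaySum * ∑ j ∈ s, (∑ l ∈ t, decay (l - j)) * x j ^ 2 := by
        rw [← Finset.mul_sum, Finset.sum_comm]
        simp_rw [Finset.sum_mul]
    _ ≤ decaySum * ∑ j ∈ s, decaySum * x j ^ 2 := by
        have := decaySum_pos
        gcongr with j _
        exact sum_decay_sub_le' j t
    _ = _ := by rw [← Finset.mul_sum]; ring

theorem summable_decay_mul (x : SeqTwo) (l : ℕ) : Summable fun j : ℕ => decay (l - j) * ‖x j‖ :=
  Summable.of_nonneg_of_le (fun _ => mul_nonneg (decay_pos _).le (norm_nonneg _))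
    (fun j => mul_le_mul_of_nonneg_left (x.norm_apply_le j) (decay_pos _).le)
    ((summable_decay_sub l).mul_right ‖x‖)

/-- Limit of the finite test in j alone. Keeping finite sums in l gives summability in l and the
bound at once. -/
theorem schur_tsum (t : Finset ℕ) (x : SeqTwo) :
    ∑ l ∈ t, (∑' j : ℕ, decay (l - j) * ‖x j‖) ^ 2 ≤ (decaySum * ‖x‖) ^ 2 := by
  have h : Filter.Tendsto (fun s : Finset ℕ => ∑ l ∈ t, (∑ j ∈ s, decay (l - j) * ‖x j‖) ^ 2)
      Filter.atTop (nhds (∑ l ∈ t, (∑' j : ℕ, decay (l - j) * ‖x j‖) ^ 2)) :=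
    tendsto_finsetSum _ fun l _ => ((summable_decay_mul x l).hasSum).pow 2
  refine le_of_tendsto' h fun s => (schur_finite s t _).trans ?_
  rw [mul_pow, SeqTwo.norm_sq]
  gcongr
  exact x.summable.sum_le_tsum s fun _ _ => sq_nonneg _

/-! ### Real-linear operators on ℓ² with small kernels -/

section Kernel

-- The entries are ℝ-linear maps, not complex numbers, because the Gram matrix involves conjugation.
variable {e : ℕ → ℕ → ℂ →L[ℝ] ℂ} {B : ℝ}

theorem norm_kernel_apply_le (he : ∀ l j, ‖e l j‖ ≤ B * decay (l - j)) (x : SeqTwo) (l j : ℕ) :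
    ‖e l j (x j)‖ ≤ B * (decay (l - j) * ‖x j‖) := by
  rw [← mul_assoc]
  exact (e l j).le_of_opNorm_le (he l j) _

theorem summable_kernel (he : ∀ l j, ‖e l j‖ ≤ B * decay (l - j)) (x : SeqTwo) (l : ℕ) :
    Summable fun j => e l j (x j) :=
  Summable.of_norm_bounded ((summable_decay_mul x l).mul_left B) (norm_kernel_apply_le he x l)

theorem sum_norm_kernel_sq_le (he : ∀ l j, ‖e l j‖ ≤ B * decay (l - j))
    (x : SeqTwo) (t : Finset ℕ) :
    ∑ l ∈ t, ‖∑' j, e l j (x j)‖ ^ 2 ≤ (B * decaySum * ‖x‖) ^ 2 := by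
  have h : ∀ l, ‖∑' j, e l j (x j)‖ ≤ B * ∑' j : ℕ, decay (l - j) * ‖x j‖ := fun l => by
    rw [← tsum_mul_left]
    exact tsum_of_norm_bounded ((summable_decay_mul x l).mul_left B).hasSum
      (norm_kernel_apply_le he x l)
  calc ∑ l ∈ t, ‖∑' j, e l j (x j)‖ ^ 2
      ≤ ∑ l ∈ t, (B * ∑' j : ℕ, decay (l - j) * ‖x j‖) ^ 2 := by gcongr with l _; exact h l
    _ = B ^ 2 * ∑ l ∈ t, (∑' j : ℕ, decay (l - j) * ‖x j‖) ^ 2 := by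
        simp_rw [mul_pow, Finset.mul_sum]
    _ ≤ B ^ 2 * (decaySum * ‖x‖) ^ 2 := by gcongr; exact schur_tsum t x
    _ = _ := by ring

theorem memℓp_kernel (he : ∀ l j, ‖e l j‖ ≤ B * decay (l - j)) (x : SeqTwo) :
    Memℓp (fun l => ∑' j, e l j (x j)) 2 :=
  memℓp_two_iff.2 (summable_of_sum_le (fun _ => sq_nonneg _) (sum_norm_kernel_sq_le he x))

/-- The operator on `ℓ²` with kernel `e`. -/
def kernelOp (hB : 0 ≤ B) (he : ∀ l j, ‖e l j‖ ≤ B * decay (l - j)) : SeqTwo →L[ℝ] SeqTwo :=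
  LinearMap.mkContinuous
    { toFun := fun x => ⟨fun l => ∑' j, e l j (x j), memℓp_kernel he x⟩
      map_add' := fun x y => by
        ext l
        simp only [lp.coeFn_add, Pi.add_apply, map_add]
        exact (summable_kernel he x l).tsum_add (summable_kernel he y l)
      map_smul' := fun c x => by
        ext l
        simp only [lp.coeFn_smul, Pi.smul_apply, map_smul, RingHom.id_apply]
        exact tsum_const_smul'' c }
    (B * decaySum) fun x => by
      have hS := decaySum_pos
      refine (sq_le_sq₀ (norm_nonneg _) (by positivity)).1 ?_
      rw [SeqTwo.norm_sq]
      exact Real.tsum_le_of_sum_le (fun _ => sq_nonneg _) (sum_norm_kernel_sq_le he x)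

theorem kernelOp_apply (hB : 0 ≤ B) (he : ∀ l j, ‖e l j‖ ≤ B * decay (l - j)) (x : SeqTwo)
    (l : ℕ) : kernelOp hB he x l = ∑' j, e l j (x j) := rfl

theorem norm_kernelOp_le (hB : 0 ≤ B) (he : ∀ l j, ‖e l j‖ ≤ B * decay (l - j)) :
    ‖kernelOp hB he‖ ≤ B * decaySum :=
  LinearMap.mkContinuous_norm_le _ (mul_nonneg hB decaySum_pos.le) _

/-- `1 + E` is invertible if the kernel of `E` is small. -/
theorem exists_kernel_inverse (hB : 0 ≤ B) (he : ∀ l j, ‖e l j‖ ≤ B * decay (l - j))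
    (hsmall : B * decaySum ≤ 1 / 2) :
    ∃ R : SeqTwo →ₗ[ℝ] SeqTwo, ∀ b, R b + kernelOp hB he (R b) = b := by
  have hlt : ‖-kernelOp hB he‖ < 1 := by
    rw [norm_neg]
    linarith [norm_kernelOp_le hB he]
  have hu := isUnit_one_sub_of_norm_lt_one hlt
  obtain ⟨u, hu⟩ := hu
  -- Only a linear right inverse is kept: the estimates of `R b` are derived later from the
  -- equation, separately for each weight.
  refine ⟨(↑u⁻¹ : SeqTwo →L[ℝ] SeqTwo).toLinearMap, fun b => ?_⟩
  have h1 : (u : SeqTwo →L[ℝ] SeqTwo) * (↑u⁻¹ : SeqTwo →L[ℝ] SeqTwo) = 1 := u.mul_inv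
  have h2 := congrArg (fun F : SeqTwo →L[ℝ] SeqTwo => F b) h1
  simpa [hu] using h2

end Kernel

/-! ### Test functions, derivatives and moments in `H^k_0(0,T)` -/

theorem memLp_of_continuous (T : ℝ) {f : ℝ → ℝ} (hf : Continuous f) :
    MemLp f 2 (volume.restrict (Ioo (0 : ℝ) T)) := by
  obtain ⟨M, hM⟩ := (isCompact_Icc (a := (0 : ℝ)) (b := T)).exists_bound_of_continuousOn
    hf.continuousOn
  refine MemLp.of_bound hf.aestronglyMeasurable M ?_
  filter_upwards [ae_restrict_mem measurableSet_Ioo] with t ht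
  exact hM t (Ioo_subset_Icc_self ht)

/-- The class in `L²(0,T)` of a continuous function. -/
def contL2 (T : ℝ) (f : ℝ → ℝ) (hf : Continuous f) : L2 T := (memLp_of_continuous T hf).toLp f

theorem contL2_ae (T : ℝ) {f : ℝ → ℝ} (hf : Continuous f) :
    contL2 T f hf =ᵐ[volume.restrict (Ioo (0 : ℝ) T)] f := MemLp.coeFn_toLp _

theorem norm_contL2_le {T : ℝ} (hT : 0 < T) {f : ℝ → ℝ} (hf : Continuous f) {M : ℝ}
    (hM : ∀ t ∈ Ioo 0 T, |f t| ≤ M) : ‖contL2 T f hf‖ ≤ Real.sqrt T * M := by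
  have hM0 : 0 ≤ M := (abs_nonneg _).trans (hM (T / 2) ⟨by linarith, by linarith⟩)
  refine (Lp.norm_le_of_ae_bound hM0 ?_).trans (le_of_eq ?_)
  · filter_upwards [contL2_ae T hf, ae_restrict_mem measurableSet_Ioo] with t ht h2
    rw [ht]
    exact hM t h2
  · congr 1
    rw [Real.sqrt_eq_rpow]
    simp [measureUnivNNReal, ENNReal.coe_toNNReal_eq_toReal, hT.le]

theorem integral_mul_eq_inner {T : ℝ} (u : L2 T) {f : ℝ → ℝ} (hf : Continuous f) :
    ∫ t in Ioo 0 T, u t * f t = inner ℝ (contL2 T f hf) u := by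
  rw [L2.inner_def]
  refine integral_congr_ae ?_
  filter_upwards [contL2_ae T hf] with t ht
  rw [ht]
  simp

theorem norm_sq_eq_integral {T : ℝ} (u : L2 T) : ‖u‖ ^ 2 = ∫ t in Ioo 0 T, u t ^ 2 := by
  rw [← real_inner_self_eq_norm_sq, L2.inner_def]
  refine integral_congr_ae (ae_of_all _ fun t => ?_)
  simp [sq]

theorem integrable_mul_ofReal {T : ℝ} (u : L2 T) {ψ : ℝ → ℂ} (hψ : Continuous ψ) :
    Integrable (fun t => (u t : ℂ) * ψ t) (volume.restrict (Ioo (0 : ℝ) T)) := by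
  obtain ⟨M, hM⟩ := (isCompact_Icc (a := (0 : ℝ)) (b := T)).exists_bound_of_continuousOn
    hψ.continuousOn
  have h1 : Integrable (fun t => (u t : ℂ)) (volume.restrict (Ioo (0 : ℝ) T)) :=
    ((Lp.memLp u).integrable (by norm_num)).ofReal
  refine h1.mul_bdd (c := M) hψ.aestronglyMeasurable ?_
  filter_upwards [ae_restrict_mem measurableSet_Ioo] with t ht
  exact hM t (Ioo_subset_Icc_self ht)

/-- The functional `u ↦ ∫₀ᵀ u ψ` on `L²(0,T)`, for a continuous complex valued `ψ`. -/
def moment (T : ℝ) (ψ : ℝ → ℂ) (hψ : Continuous ψ) : L2 T →L[ℝ] ℂ :=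
  Complex.ofRealCLM ∘L innerSL ℝ (contL2 T (fun t => (ψ t).re) (Complex.continuous_re.comp hψ))
  + Complex.I • (Complex.ofRealCLM ∘L
      innerSL ℝ (contL2 T (fun t => (ψ t).im) (Complex.continuous_im.comp hψ)))

theorem moment_apply {T : ℝ} {ψ : ℝ → ℂ} (hψ : Continuous ψ) (u : L2 T) :
    moment T ψ hψ u = ∫ t in Ioo 0 T, (u t : ℂ) * ψ t := by
  have h1 := integral_mul_eq_inner u (Complex.continuous_re.comp hψ)
  have h2 := integral_mul_eq_inner u (Complex.continuous_im.comp hψ)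
  have h3 := integrable_mul_ofReal u hψ
  simp only [moment, add_apply, smul_apply,
    ContinuousLinearMap.comp_apply, innerSL_apply_apply, Complex.ofRealCLM_apply]
  erw [← h1, ← h2]
  refine Complex.ext ?_ ?_
  · have := integral_re h3
    simp only [RCLike.re_eq_complex_re] at this
    rw [← this]
    simp
  · have := integral_im h3
    simp only [RCLike.im_eq_complex_im] at this
    rw [← this]
    simp

/-- The factor 2 comes from treating real and imaginary parts separately. The bound sees only the
size of `ψ`, so it is uniform in the frequency of an exponential. -/
theorem norm_moment_le {T : ℝ} (hT : 0 < T) {ψ : ℝ → ℂ} (hψ : Continuous ψ) {M : ℝ}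
    (hM : ∀ t ∈ Ioo 0 T, ‖ψ t‖ ≤ M) (u : L2 T) :
    ‖moment T ψ hψ u‖ ≤ 2 * (Real.sqrt T * M) * ‖u‖ := by
  simp only [moment, add_apply, smul_apply,
    ContinuousLinearMap.comp_apply, innerSL_apply_apply, Complex.ofRealCLM_apply]
  refine (norm_add_le _ _).trans ?_
  have h1 := norm_contL2_le hT (Complex.continuous_re.comp hψ) (M := M)
    fun t ht => (Complex.abs_re_le_norm _).trans (hM t ht)
  have h2 := norm_contL2_le hT (Complex.continuous_im.comp hψ) (M := M)
    fun t ht => (Complex.abs_im_le_norm _).trans (hM t ht)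
  have h3 := (norm_inner_le_norm (𝕜 := ℝ) _ u).trans
    (mul_le_mul_of_nonneg_right h1 (norm_nonneg u))
  have h4 := (norm_inner_le_norm (𝕜 := ℝ) _ u).trans
    (mul_le_mul_of_nonneg_right h2 (norm_nonneg u))
  simp only [smul_eq_mul, norm_mul, Complex.norm_I, one_mul, Complex.norm_real]
  refine (add_le_add h3 h4).trans (le_of_eq ?_)
  ring

theorem contDiff_iteratedDeriv {h : ℝ → ℝ} (hs : ContDiff ℝ ((⊤ : ℕ∞) : WithTop ℕ∞) h) (m : ℕ) :
    ContDiff ℝ ((⊤ : ℕ∞) : WithTop ℕ∞) (iteratedDeriv m h) := by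
  induction m with
  | zero => simpa using hs
  | succ m ih => rw [iteratedDeriv_succ]; exact contDiff_deriv ih

theorem integral_mul_iteratedDeriv (m : ℕ) : ∀ {T : ℝ} {φ ψ : ℝ → ℝ}, IsTest T φ → IsTest T ψ →
    ∫ t, φ t * iteratedDeriv m ψ t = (-1) ^ m * ∫ t, iteratedDeriv m φ t * ψ t := by
  induction m with
  | zero => intros; simp
  | succ m ih =>
    intro T φ ψ hφ hψ
    have hsm : ContDiff ℝ ((⊤ : ℕ∞) : WithTop ℕ∞) (iteratedDeriv m ψ) :=
      contDiff_iteratedDeriv hψ.smooth m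
    have hc := hasCompactSupport_iteratedDeriv hψ.compact m
    have key := integral_mul_deriv_eq_deriv_mul_of_integrable (u := φ) (u' := deriv φ)
      (v := iteratedDeriv m ψ) (v' := deriv (iteratedDeriv m ψ))
      (fun t _ => ((hφ.smooth.differentiable (by simp)) t).hasDerivAt)
      (fun t _ => ((hsm.differentiable (by simp)) t).hasDerivAt)
      ((hφ.smooth.continuous.mul (contDiff_deriv hsm).continuous).integrable_of_hasCompactSupport
        hφ.compact.mul_right)
      ((hφ.deriv.smooth.continuous.mul hsm.continuous).integrable_of_hasCompactSupport hc.mul_left)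
      ((hφ.smooth.continuous.mul hsm.continuous).integrable_of_hasCompactSupport hc.mul_left)
    rw [iteratedDeriv_succ, key, ih hφ.deriv hψ, iteratedDeriv_succ', pow_succ]
    ring

theorem setIntegral_mul_test {T : ℝ} {E : Type*} [NormedAddCommGroup E] [NormedSpace ℝ E]
    {φ : ℝ → ℝ} (hφ : IsTest T φ) {f : ℝ → E} (hf : ∀ t, φ t = 0 → f t = 0) :
    ∫ t in Ioo 0 T, f t = ∫ t, f t :=
  setIntegral_eq_integral_of_forall_compl_eq_zero fun t ht => hf t (by
    by_contra h
    exact ht (hφ.support (subset_tsupport _ h)))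

/-- A test function as an element of `H^k_0(0,T)`. -/
def ofTest {T : ℝ} (k : ℕ) {φ : ℝ → ℝ} (hφ : IsTest T φ) : sobolevZero T k :=
  ⟨⟨WithLp.toLp 2 fun m => contL2 T (iteratedDeriv m φ) (continuous_iteratedDeriv_test hφ m), by
    intro m ψ hψ
    have h0 : ∫ t in Ioo 0 T, contL2 T (iteratedDeriv ((0 : Fin (k + 1)) : ℕ) φ)
        (continuous_iteratedDeriv_test hφ _) t * iteratedDeriv m ψ t
        = ∫ t in Ioo 0 T, φ t * iteratedDeriv m ψ t := by
      refine integral_congr_ae ?_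
      filter_upwards [contL2_ae T (continuous_iteratedDeriv_test hφ ((0 : Fin (k + 1)) : ℕ))]
        with t ht
      rw [ht]
      simp
    have h1 : ∫ t in Ioo 0 T, contL2 T (iteratedDeriv m φ)
        (continuous_iteratedDeriv_test hφ _) t * ψ t
        = ∫ t in Ioo 0 T, iteratedDeriv m φ t * ψ t := by
      refine integral_congr_ae ?_
      filter_upwards [contL2_ae T (continuous_iteratedDeriv_test hφ m)] with t ht
      rw [ht]
    refine h0.trans ?_
    rw [h1, setIntegral_mul_test hφ fun t ht => by rw [ht, zero_mul],
      setIntegral_mul_test hψ fun t ht => by rw [ht, mul_zero],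
      integral_mul_iteratedDeriv m hφ hψ]⟩,
  Submodule.le_topologicalClosure _ ⟨φ, hφ, by
    have := contL2_ae T (continuous_iteratedDeriv_test hφ ((0 : Fin (k + 1)) : ℕ))
    simpa using this⟩⟩

/-- The `m`-th derivative as a continuous linear map `H^k_0(0,T) → L²(0,T)`. -/
def wderivL (T : ℝ) {k : ℕ} (m : Fin (k + 1)) : sobolevZero T k →L[ℝ] L2 T :=
  (PiLp.proj 2 (fun _ : Fin (k + 1) => L2 T) m) ∘L (sobolev T k).subtypeL
    ∘L (sobolevZero T k).subtypeL

theorem wderivL_apply {T : ℝ} {k : ℕ} (m : Fin (k + 1)) (u : sobolevZero T k) :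
    wderivL T m u = wderiv u m := rfl

theorem wderiv_ofTest {T : ℝ} {k : ℕ} {φ : ℝ → ℝ} (hφ : IsTest T φ) (m : Fin (k + 1)) :
    wderiv (ofTest k hφ) m
      = contL2 T (iteratedDeriv m φ) (continuous_iteratedDeriv_test hφ m) := rfl

theorem moment_ofTest {T : ℝ} {k : ℕ} {φ : ℝ → ℝ} (hφ : IsTest T φ) {ψ : ℝ → ℂ}
    (hψ : Continuous ψ) :
    moment T ψ hψ (wderivL T 0 (ofTest k hφ)) = ∫ t, (φ t : ℂ) * ψ t := by
  rw [moment_apply, wderivL_apply, wderiv_ofTest,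
    ← setIntegral_mul_test hφ (fun t ht => by rw [ht]; simp)]
  refine integral_congr_ae ?_
  filter_upwards [contL2_ae T (continuous_iteratedDeriv_test hφ ((0 : Fin (k + 1)) : ℕ))]
    with t ht
  rw [ht]
  simp

theorem normZero_eq {T : ℝ} {k : ℕ} (m : Fin (k + 1)) (u : sobolevZero T k) :
    normZero m u = ‖wderivL T m u‖ := by
  rw [normZero, ← norm_sq_eq_integral, Real.sqrt_sq (norm_nonneg _), wderivL_apply]

/-- Each test function imposes an equality of two continuous functionals. Closedness gives the
completeness needed to sum series in H^k_0. -/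
theorem isClosed_sobolev (T : ℝ) (k : ℕ) :
    IsClosed (sobolev T k : Set (PiLp 2 (fun _ : Fin (k + 1) => L2 T))) := by
  have : (sobolev T k : Set (PiLp 2 (fun _ : Fin (k + 1) => L2 T)))
      = ⋂ m : Fin (k + 1), ⋂ φ : ℝ → ℝ, ⋂ _ : IsTest T φ,
        {U | ∫ t in Ioo 0 T, U 0 t * iteratedDeriv m φ t
          = (-1) ^ (m : ℕ) * ∫ t in Ioo 0 T, U m t * φ t} := by
    ext U
    simp [sobolev, IsWeakDeriv]
  rw [this]
  refine isClosed_iInter fun m => isClosed_iInter fun φ => isClosed_iInter fun hφ => ?_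
  simp_rw [fun u : L2 T => integral_mul_eq_inner u (continuous_iteratedDeriv_test hφ m),
    fun u : L2 T => integral_mul_eq_inner u hφ.smooth.continuous]
  refine isClosed_eq ?_ ?_
  · exact ((innerSL ℝ (contL2 T (iteratedDeriv m φ) _)) ∘L
      (PiLp.proj 2 (fun _ : Fin (k + 1) => L2 T) 0)).continuous
  · exact continuous_const.mul ((innerSL ℝ (contL2 T φ hφ.smooth.continuous)) ∘L
      (PiLp.proj 2 (fun _ : Fin (k + 1) => L2 T) m)).continuous

instance (T : ℝ) (k : ℕ) : CompleteSpace (sobolevZero T k) := by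
  have : CompleteSpace (sobolev T k) := (isClosed_sobolev T k).completeSpace_coe
  exact (Submodule.isClosed_topologicalClosure _).completeSpace_coe

theorem norm_le_sum_wderiv {T : ℝ} {k : ℕ} (u : sobolevZero T k) :
    ‖u‖ ≤ ∑ m, ‖wderivL T m u‖ := by
  have h : ‖u‖ = Real.sqrt (∑ m, ‖wderivL T m u‖ ^ 2) := PiLp.norm_eq_of_L2 (u.1.1)
  rw [h]
  refine Real.sqrt_le_iff.2 ⟨Finset.sum_nonneg fun _ _ => norm_nonneg _, ?_⟩
  rw [sq (∑ m, ‖wderivL T m u‖), Finset.sum_mul]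
  refine Finset.sum_le_sum fun m hm => ?_
  rw [sq]
  gcongr
  exact Finset.single_le_sum (f := fun m => ‖wderivL T m u‖) (fun _ _ => norm_nonneg _) hm

/-! ### Frequencies with a uniform gap -/

/-- The sequence `lam` starts beyond `γ` and has gaps at least `γ`. -/
structure GapSeq (γ : ℝ) (lam : ℕ → ℝ) : Prop where
  first : γ ≤ lam 0
  gap : ∀ j, γ ≤ lam (j + 1) - lam j

namespace GapSeq

variable {γ : ℝ} {lam : ℕ → ℝ}

theorem mono_gap (h : GapSeq γ lam) {γ' : ℝ} (hγ : γ' ≤ γ) : GapSeq γ' lam :=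
  ⟨hγ.trans h.first, fun j => hγ.trans (h.gap j)⟩

theorem add_le (h : GapSeq γ lam) (j i : ℕ) : lam j + γ * i ≤ lam (j + i) := by
  induction i with
  | zero => simp
  | succ i ih =>
    have := h.gap (j + i)
    rw [← add_assoc]
    push_cast
    linarith

theorem lower (h : GapSeq γ lam) (j : ℕ) : γ * (j + 1) ≤ lam j := by
  have h1 := h.add_le 0 j
  have h2 := h.first
  rw [zero_add] at h1
  linarith

theorem one_le (h : GapSeq γ lam) (hγ : 1 ≤ γ) (j : ℕ) : 1 ≤ lam j := by
  have h1 := h.lower j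
  have h2 : (0 : ℝ) ≤ j := j.cast_nonneg
  nlinarith

theorem le_abs_sub (h : GapSeq γ lam) (l j : ℕ) :
    γ * |(((l : ℤ) - (j : ℤ) : ℤ) : ℝ)| ≤ |lam l - lam j| := by
  push_cast
  rcases le_total j l with hjl | hjl
  · obtain ⟨i, rfl⟩ := Nat.exists_eq_add_of_le hjl
    have := h.add_le j i
    refine le_trans (le_of_eq ?_) (le_trans (by linarith : γ * i ≤ _) (le_abs_self _))
    simp
  · obtain ⟨i, rfl⟩ := Nat.exists_eq_add_of_le hjl
    have := h.add_le l i
    rw [abs_sub_comm (lam l)]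
    refine le_trans (le_of_eq ?_) (le_trans (by linarith : γ * i ≤ _) (le_abs_self _))
    simp

/-- Sums of frequencies arise from the conjugate exponentials hidden in real parts. The bound λ_j ≥
γ(j+1), which uses the condition on the first term, makes them large too. -/
theorem le_add (h : GapSeq γ lam) (hγ : 0 ≤ γ) (l j : ℕ) :
    γ * (1 + |(((l : ℤ) - (j : ℤ) : ℤ) : ℝ)|) ≤ lam l + lam j := by
  have h1 := h.lower l
  have h2 := h.lower j
  have h3 : |(((l : ℤ) - (j : ℤ) : ℤ) : ℝ)| ≤ l + j := by
    push_cast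
    exact abs_le.2 ⟨by linarith [(l.cast_nonneg : (0 : ℝ) ≤ l)],
      by linarith [(j.cast_nonneg : (0 : ℝ) ≤ j)]⟩
  nlinarith

end GapSeq

/-! ### Modulated test functions -/

/-- The real function `ρ Re f`. -/
def modul (ρ : ℝ → ℝ) (f : ℝ → ℂ) : ℝ → ℝ := fun t => ρ t * (f t).re

theorem IsTest.modul {T : ℝ} {ρ : ℝ → ℝ} (hρ : IsTest T ρ) {f : ℝ → ℂ}
    (hf : ContDiff ℝ ((⊤ : ℕ∞) : WithTop ℕ∞) f) : IsTest T (modul ρ f) :=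
  ⟨hρ.smooth.mul (Complex.reCLM.contDiff.comp hf), hρ.compact.mul_right,
    (tsupport_mul_subset_left).trans hρ.support⟩

/-- The trigonometric sum `∑_{j ∈ s} c_j e^{-i λ_j t}`. -/
def trig (s : Finset ℕ) (lam : ℕ → ℝ) (c : ℕ → ℂ) (t : ℝ) : ℂ :=
  ∑ j ∈ s, c j * Complex.exp (Complex.I * (-lam j : ℝ) * t)

theorem contDiff_trig (s : Finset ℕ) (lam : ℕ → ℝ) (c : ℕ → ℂ) :
    ContDiff ℝ ((⊤ : ℕ∞) : WithTop ℕ∞) (trig s lam c) := by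
  unfold trig
  exact ContDiff.sum fun _ _ => contDiff_const.mul (contDiff_expI _)

theorem hasDerivAt_trig (s : Finset ℕ) (lam : ℕ → ℝ) (c : ℕ → ℂ) (t : ℝ) :
    HasDerivAt (trig s lam c) (trig s lam (fun j => -(Complex.I * lam j) * c j) t) t := by
  have h : HasDerivAt (trig s lam c) (∑ j ∈ s, c j * (Complex.I * (-lam j : ℝ)
      * Complex.exp (Complex.I * (-lam j : ℝ) * t))) t := by
    unfold trig
    exact HasDerivAt.fun_sum fun j _ => (hasDerivAt_expI (-lam j) t).const_mul (c j)
  convert h using 1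
  rw [trig]
  refine Finset.sum_congr rfl fun j _ => ?_
  push_cast
  ring

/-- Leibniz' rule stays within modulated sums, changing either the bump or the coefficients. This
permits induction on the order of differentiation, for all bumps at once. -/
theorem deriv_modul_trig {T : ℝ} {ρ : ℝ → ℝ} (hρ : IsTest T ρ) (s : Finset ℕ) (lam : ℕ → ℝ)
    (c : ℕ → ℂ) : deriv (modul ρ (trig s lam c)) = modul (deriv ρ) (trig s lam c)
      + modul ρ (trig s lam fun j => -(Complex.I * lam j) * c j) := by
  funext t
  have h1 : HasDerivAt ρ (deriv ρ t) t :=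
    ((hρ.smooth.differentiable (by simp)) t).hasDerivAt
  have h2 : HasDerivAt (fun t => (trig s lam c t).re)
      (trig s lam (fun j => -(Complex.I * lam j) * c j) t).re t :=
    Complex.reCLM.hasFDerivAt.comp_hasDerivAt t (hasDerivAt_trig s lam c t)
  exact (h1.mul h2).deriv

/-- A smooth majorant of the indicator of (0,T): unlike the indicator, it has a rapidly decaying
Fourier transform. -/
theorem exists_plateau {T : ℝ} (hT : 0 < T) : ∃ θ : ℝ → ℝ,
    ContDiff ℝ ((⊤ : ℕ∞) : WithTop ℕ∞) θ ∧ HasCompactSupport θ ∧ (∀ t, 0 ≤ θ t) ∧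
    ∀ t ∈ Ioo 0 T, θ t = 1 := by
  let f : ContDiffBump (T / 2) := ⟨T, 2 * T, hT, by linarith⟩
  refine ⟨f, f.contDiff, f.hasCompactSupport, fun t => f.nonneg, fun t ht => ?_⟩
  refine f.one_of_mem_closedBall ?_
  rw [Real.closedBall_eq_Icc]
  exact ⟨by show T / 2 - T ≤ t; linarith [ht.1], by show t ≤ T / 2 + T; linarith [ht.2]⟩

theorem integral_mul_normSq_trig {θ : ℝ → ℝ} (hs : ContDiff ℝ ((⊤ : ℕ∞) : WithTop ℕ∞) θ)
    (hc : HasCompactSupport θ) (s : Finset ℕ) (lam : ℕ → ℝ) (c : ℕ → ℂ) :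
    ((∫ t, θ t * ‖trig s lam c t‖ ^ 2 : ℝ) : ℂ) = ∑ l ∈ s, ∑ j ∈ s,
      (starRingEnd ℂ (c l)) * c j * FT (fun t => (θ t : ℂ)) (lam l - lam j) := by
  have hpt : ∀ t, ((θ t * ‖trig s lam c t‖ ^ 2 : ℝ) : ℂ) = ∑ l ∈ s, ∑ j ∈ s,
      (starRingEnd ℂ (c l)) * c j *
        ((θ t : ℂ) * Complex.exp (Complex.I * (lam l - lam j : ℝ) * t)) := by
    intro t
    push_cast
    rw [← Complex.conj_mul', trig, map_sum, Finset.sum_mul_sum, Finset.mul_sum]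
    refine Finset.sum_congr rfl fun l _ => ?_
    rw [Finset.mul_sum]
    refine Finset.sum_congr rfl fun j _ => ?_
    rw [map_mul, ← Complex.exp_conj, show Complex.I * ((lam l : ℂ) - lam j) * t
      = Complex.I * lam l * t + Complex.I * ((-lam j : ℝ) : ℂ) * t by push_cast; ring,
      Complex.exp_add]
    simp
    ring
  rw [← integral_complex_ofReal]
  simp_rw [hpt]
  have hint : ∀ x : ℝ, Integrable fun t => (θ t : ℂ) * Complex.exp (Complex.I * x * t) :=
    fun x => ((Complex.continuous_ofReal.comp hs.continuous).mul
      (continuous_expI x)).integrable_of_hasCompactSupport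
      (HasCompactSupport.mul_right (hc.comp_left (g := ((↑) : ℝ → ℂ)) Complex.ofReal_zero))
  rw [integral_finsetSum _ fun l _ => integrable_finsetSum _ fun j _ => (hint _).const_mul _]
  refine Finset.sum_congr rfl fun l _ => ?_
  rw [integral_finsetSum _ fun j _ => (hint _).const_mul _]
  refine Finset.sum_congr rfl fun j _ => ?_
  rw [integral_const_mul, FT]

/-- The Bessel inequality on `(0,T)` for frequencies with gap at least `1`. -/
theorem exists_bessel {T : ℝ} (hT : 0 < T) : ∃ C : ℝ, 0 ≤ C ∧ ∀ lam : ℕ → ℝ, GapSeq 1 lam →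
    ∀ (s : Finset ℕ) (c : ℕ → ℂ),
    ‖contL2 T (fun t => (trig s lam c t).re)
      (Complex.continuous_re.comp (contDiff_trig s lam c).continuous)‖
      ≤ C * Real.sqrt (∑ j ∈ s, ‖c j‖ ^ 2) := by
  obtain ⟨θ, hs, hc, h0, h1⟩ := exists_plateau hT
  obtain ⟨A, hA, hdec⟩ := exists_FT_decay (h := fun t => (θ t : ℂ))
    (Complex.ofRealCLM.contDiff.comp hs)
    (hc.comp_left (g := ((↑) : ℝ → ℂ)) Complex.ofReal_zero) 2
  have hS := decaySum_pos
  refine ⟨Real.sqrt (A * decaySum), Real.sqrt_nonneg _, fun lam hlam s c => ?_⟩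
  rw [← Real.sqrt_mul (by positivity)]
  refine Real.le_sqrt_of_sq_le ?_
  have hcont := (contDiff_trig s lam c).continuous
  have hintθ : Integrable fun t => θ t * ‖trig s lam c t‖ ^ 2 :=
    (hs.continuous.mul (hcont.norm.pow 2)).integrable_of_hasCompactSupport hc.mul_right
  have hker : ∀ l j : ℕ, ‖FT (fun t => (θ t : ℂ)) (lam l - lam j)‖ ≤ A * decay (l - j) := by
    intro l j
    have h2 := hlam.le_abs_sub l j
    have h3 := hdec (lam l - lam j)
    rw [one_mul] at h2
    rw [decay, mul_one_div, le_div_iff₀ (by positivity), mul_comm]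
    refine le_trans ?_ h3
    gcongr
  -- Cauchy–Schwarz in l, then Schur's test for the inner sums.
  have hsum : ∑ l ∈ s, ‖c l‖ * ∑ j ∈ s, decay (l - j) * ‖c j‖
      ≤ decaySum * ∑ j ∈ s, ‖c j‖ ^ 2 := by
    have hn : 0 ≤ ∑ j ∈ s, ‖c j‖ ^ 2 := Finset.sum_nonneg fun _ _ => sq_nonneg _
    refine abs_le_of_sq_le_sq' ?_ (by positivity) |>.2
    refine (Finset.sum_mul_sq_le_sq_mul_sq s _ _).trans ?_
    refine (mul_le_mul_of_nonneg_left (schur_finite s s _) hn).trans (le_of_eq ?_)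
    ring
  have key : ‖contL2 T (fun t => (trig s lam c t).re) (Complex.continuous_re.comp hcont)‖ ^ 2
      ≤ ∫ t, θ t * ‖trig s lam c t‖ ^ 2 := by
    rw [norm_sq_eq_integral]
    calc _ = ∫ t in Ioo 0 T, (trig s lam c t).re ^ 2 := by
          refine integral_congr_ae ?_
          filter_upwards [contL2_ae T (Complex.continuous_re.comp hcont)] with t ht
          exact congrArg (fun x => x ^ 2) ht
      _ ≤ ∫ t in Ioo 0 T, θ t * ‖trig s lam c t‖ ^ 2 := by
          refine setIntegral_mono_on ?_ hintθ.integrableOn measurableSet_Ioo fun t ht => ?_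
          · exact (memLp_of_continuous T (Complex.continuous_re.comp hcont)).integrable_sq
          · rw [h1 t ht, one_mul, ← sq_abs]
            gcongr
            exact Complex.abs_re_le_norm _
      _ ≤ _ := setIntegral_le_integral hintθ
          (ae_of_all _ fun t => mul_nonneg (h0 t) (sq_nonneg _))
  refine key.trans ?_
  refine (le_abs_self _).trans ?_
  rw [← Real.norm_eq_abs, ← Complex.norm_real, integral_mul_normSq_trig hs hc]
  calc _ ≤ ∑ l ∈ s, ∑ j ∈ s, ‖c l‖ * ‖c j‖ * (A * decay (l - j)) := by
        refine norm_sum_le_of_le _ fun l _ => norm_sum_le_of_le _ fun j _ => ?_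
        rw [norm_mul, norm_mul, RCLike.norm_conj]
        gcongr
        exact_mod_cast hker l j
    _ = A * ∑ l ∈ s, ‖c l‖ * ∑ j ∈ s, decay (l - j) * ‖c j‖ := by
        simp_rw [Finset.mul_sum]
        refine Finset.sum_congr rfl fun l _ => Finset.sum_congr rfl fun j _ => ?_
        ring
    _ ≤ A * (decaySum * ∑ j ∈ s, ‖c j‖ ^ 2) := by gcongr
    _ = _ := by ring

theorem contL2_add (T : ℝ) {f g h : ℝ → ℝ} (hf : Continuous f) (hg : Continuous g)
    (hh : Continuous h) (hfg : h = f + g) : contL2 T h hh = contL2 T f hf + contL2 T g hg := by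
  subst hfg
  exact MemLp.toLp_add _ _

theorem contL2_smul (T : ℝ) {f h : ℝ → ℝ} (r : ℝ) (hf : Continuous f)
    (hh : Continuous h) (hfh : h = r • f) : contL2 T h hh = r • contL2 T f hf := by
  subst hfh
  exact MemLp.toLp_const_smul _ _

theorem iteratedDeriv_add_test {T : ℝ} {φ ψ : ℝ → ℝ} (hφ : IsTest T φ) (hψ : IsTest T ψ)
    (m : ℕ) : iteratedDeriv m (φ + ψ) = iteratedDeriv m φ + iteratedDeriv m ψ := by
  funext t
  exact iteratedDeriv_add ((hφ.smooth.of_le (by exact_mod_cast le_top)).contDiffAt)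
    ((hψ.smooth.of_le (by exact_mod_cast le_top)).contDiffAt)

theorem iteratedDeriv_smul_real {φ : ℝ → ℝ} (r : ℝ)
    (m : ℕ) : iteratedDeriv m (r • φ) = r • iteratedDeriv m φ := by
  funext t
  exact iteratedDeriv_const_smul_field r φ

/-- The derivatives of a modulated trigonometric sum. -/
theorem exists_modul_bound {T : ℝ} (hT : 0 < T) (m : ℕ) : ∀ {ρ : ℝ → ℝ} (hρ : IsTest T ρ),
    ∃ C : ℝ, 0 ≤ C ∧ ∀ lam : ℕ → ℝ, GapSeq 1 lam → ∀ (s : Finset ℕ) (c : ℕ → ℂ),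
    ‖contL2 T (iteratedDeriv m (modul ρ (trig s lam c)))
      (continuous_iteratedDeriv_test (hρ.modul (contDiff_trig s lam c)) m)‖
      ≤ C * Real.sqrt (∑ j ∈ s, ‖(lam j : ℂ) ^ m * c j‖ ^ 2) := by
  induction m with
  | zero =>
    intro ρ hρ
    obtain ⟨C, hC, hb⟩ := exists_bessel hT
    obtain ⟨M, hM⟩ := hρ.compact.exists_bound_of_continuous hρ.smooth.continuous
    have hM0 : 0 ≤ M := (norm_nonneg _).trans (hM 0)
    refine ⟨M * C, by positivity, fun lam hlam s c => ?_⟩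
    have h2 := hb lam hlam s c
    have hcont := Complex.continuous_re.comp (contDiff_trig s lam c).continuous
    have h1 : ‖contL2 T (iteratedDeriv 0 (modul ρ (trig s lam c)))
        (continuous_iteratedDeriv_test (hρ.modul (contDiff_trig s lam c)) 0)‖
        ≤ M * ‖contL2 T (fun t => (trig s lam c t).re) hcont‖ := by
      refine Lp.norm_le_mul_norm_of_ae_le_mul ?_
      filter_upwards [contL2_ae T hcont, contL2_ae T
        (continuous_iteratedDeriv_test (hρ.modul (contDiff_trig s lam c)) 0)] with t ht1 ht2
      rw [ht2]
      refine le_trans ?_ (mul_le_mul_of_nonneg_left (le_of_eq (congrArg _ ht1.symm)) hM0)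
      rw [iteratedDeriv_zero, modul, norm_mul]
      exact mul_le_mul_of_nonneg_right (hM t) (norm_nonneg _)
    refine h1.trans ?_
    simp only [pow_zero, one_mul]
    rw [mul_assoc]
    gcongr
  | succ m ih =>
    intro ρ hρ
    obtain ⟨C, hC, hb⟩ := ih hρ
    obtain ⟨C', hC', hb'⟩ := ih hρ.deriv
    refine ⟨C' + C, by positivity, fun lam hlam s c => ?_⟩
    have hd := deriv_modul_trig hρ s lam c
    have h1 := hb lam hlam s fun j => -(Complex.I * lam j) * c j
    have h2 := hb' lam hlam s c
    rw [contL2_add T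
      (continuous_iteratedDeriv_test (hρ.deriv.modul (contDiff_trig s lam c)) m)
      (continuous_iteratedDeriv_test (hρ.modul (contDiff_trig s lam _)) m) _
      (by rw [iteratedDeriv_succ', hd]; exact iteratedDeriv_add_test
            (hρ.deriv.modul (contDiff_trig s lam c)) (hρ.modul (contDiff_trig s lam _)) m), add_mul]
    refine (norm_add_le _ _).trans (add_le_add (h2.trans ?_) (h1.trans (le_of_eq ?_)))
    -- The term with ρ' carries only the power m of λ_j; since λ_j ≥ 1 it may be raised to m + 1.
    · gcongr with j _
      rw [norm_mul, norm_mul]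
      gcongr
      rw [norm_pow, norm_pow]
      have := hlam.one_le le_rfl j
      refine pow_le_pow_right₀ ?_ (Nat.le_succ m)
      rw [Complex.norm_real]
      exact this.trans (le_abs_self _)
    · congr 2
      refine Finset.sum_congr rfl fun j _ => ?_
      refine congrArg (fun x => x ^ 2) ?_
      rw [pow_succ]
      simp [mul_assoc]

/-! ### Synthesis of solutions and the moment problem for frequencies with large gaps -/

/-- The space of test functions on `(0,T)`. -/
def testSpace (T : ℝ) : Submodule ℝ (ℝ → ℝ) where
  carrier := {φ | IsTest T φ}
  add_mem' := fun {φ ψ} hφ hψ => ⟨hφ.smooth.add hψ.smooth, hφ.compact.add hψ.compact,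
    (tsupport_add φ ψ).trans (union_subset hφ.support hψ.support)⟩
  zero_mem' := ⟨contDiff_const, HasCompactSupport.zero, by simp⟩
  smul_mem' := fun c φ hφ => ⟨hφ.smooth.const_smul c, hφ.compact.smul_left (f := fun _ => c),
    (tsupport_smul_subset_right (fun _ => c) φ).trans hφ.support⟩

/-- The inclusion of the test functions in `H^k_0(0,T)`. -/
def ofTestL (T : ℝ) (k : ℕ) : testSpace T →ₗ[ℝ] sobolevZero T k where
  toFun φ := ofTest k φ.2
  map_add' φ ψ := Subtype.ext <| Subtype.ext <| PiLp.ext fun m =>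
    contL2_add T (continuous_iteratedDeriv_test φ.2 m) (continuous_iteratedDeriv_test ψ.2 m)
      (continuous_iteratedDeriv_test (φ + ψ).2 m)
      (iteratedDeriv_add_test φ.2 ψ.2 m)
  map_smul' c φ := Subtype.ext <| Subtype.ext <| PiLp.ext fun m =>
    contL2_smul T c (continuous_iteratedDeriv_test φ.2 m)
      (continuous_iteratedDeriv_test (c • φ).2 m) (iteratedDeriv_smul_real c m)

/-- `z ↦ ρ(t) Re (z e^{-ixt})`. -/
def wave {T : ℝ} {ρ : ℝ → ℝ} (hρ : IsTest T ρ) (x : ℝ) : ℂ →ₗ[ℝ] testSpace T where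
  toFun z := ⟨modul ρ fun t => z * Complex.exp (Complex.I * (-x : ℝ) * t),
    hρ.modul (contDiff_const.mul (contDiff_expI _))⟩
  map_add' z w := Subtype.ext <| funext fun t => by simp [modul]; ring
  map_smul' c z := Subtype.ext <| funext fun t => by simp [modul]; ring

/-- `z ↦ ρ(t) Re (z e^{-ixt})` as a map to `H^k_0(0,T)`. -/
def atom {T : ℝ} (k : ℕ) {ρ : ℝ → ℝ} (hρ : IsTest T ρ) (x : ℝ) : ℂ →ₗ[ℝ] sobolevZero T k :=
  ofTestL T k ∘ₗ wave hρ x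

/-- Partial sums of the series are single modulated trigonometric sums, so the Bessel bounds apply
to them. -/
theorem sum_atom {T : ℝ} (k : ℕ) {ρ : ℝ → ℝ} (hρ : IsTest T ρ) (lam : ℕ → ℝ) (s : Finset ℕ)
    (c : ℕ → ℂ) : ∑ j ∈ s, atom k hρ (lam j) (c j)
      = ofTest k (hρ.modul (contDiff_trig s lam c)) := by
  simp only [atom, LinearMap.comp_apply]
  rw [← map_sum]
  change _ = ofTestL T k ⟨_, hρ.modul (contDiff_trig s lam c)⟩
  refine congrArg (ofTestL T k) (Subtype.ext ?_)
  funext t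
  simp [wave, modul, trig]
  rw [← Finset.sum_sub_distrib, Finset.mul_sum]

/-- Writing Re w = (w + w̄)/2 turns a wave into two modulations of ρ, with frequencies x and -x. -/
theorem FT_wave {T : ℝ} {ρ : ℝ → ℝ} (hρ : IsTest T ρ) (x y : ℝ) (z : ℂ) :
    FT (fun t => ((wave hρ x z).1 t : ℂ)) y = 1 / 2 * (z * FT (fun t => (ρ t : ℂ)) (y - x)
      + starRingEnd ℂ z * FT (fun t => (ρ t : ℂ)) (y + x)) := by
  have hint : ∀ x : ℝ, Integrable fun t => (ρ t : ℂ) * Complex.exp (Complex.I * x * t) :=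
    fun x => (hρ.ofReal.smooth.continuous.mul
      (continuous_expI x)).integrable_of_hasCompactSupport hρ.ofReal.compact.mul_right
  simp only [FT]
  rw [← integral_const_mul, ← integral_const_mul, ← integral_add ((hint _).const_mul _)
    ((hint _).const_mul _), ← integral_const_mul]
  refine integral_congr_ae (ae_of_all _ fun t => ?_)
  have h1 : ((z * Complex.exp (Complex.I * (-x : ℝ) * t)).re : ℂ)
      = 1 / 2 * (z * Complex.exp (Complex.I * (-x : ℝ) * t)
        + starRingEnd ℂ z * Complex.exp (Complex.I * x * t)) := by
    rw [Complex.re_eq_add_conj, map_mul, ← Complex.exp_conj]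
    simp
    ring
  have h2 : Complex.exp (Complex.I * (y - x : ℝ) * t)
      = Complex.exp (Complex.I * (-x : ℝ) * t) * Complex.exp (Complex.I * y * t) := by
    rw [← Complex.exp_add]
    congr 1
    push_cast
    ring
  have h3 : Complex.exp (Complex.I * (y + x : ℝ) * t)
      = Complex.exp (Complex.I * x * t) * Complex.exp (Complex.I * y * t) := by
    rw [← Complex.exp_add]
    congr 1
    push_cast
    ring
  simp only [wave, modul, LinearMap.coe_mk, AddHom.coe_mk]
  rw [Complex.ofReal_mul, h1, h2, h3]
  ring

/-- The moment `u ↦ ∫₀ᵀ u(t) e^{iyt} dt`. -/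
def expMoment (T : ℝ) (k : ℕ) (y : ℝ) : sobolevZero T k →L[ℝ] ℂ :=
  moment T (fun t => Complex.exp (Complex.I * y * t)) (continuous_expI y) ∘L wderivL T 0

theorem expMoment_apply {T : ℝ} {k : ℕ} (y : ℝ) (u : sobolevZero T k) :
    expMoment T k y u = ∫ t in Ioo 0 T, (toFn u t : ℂ) * Complex.exp (Complex.I * y * t) :=
  moment_apply (continuous_expI y) _

theorem expMoment_ofTestL {T : ℝ} {k : ℕ} (y : ℝ) (φ : testSpace T) :
    expMoment T k y (ofTestL T k φ) = FT (fun t => (φ.1 t : ℂ)) y := by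
  have h := moment_ofTest (k := k) φ.2 (continuous_expI y)
  rw [FT, ← h]
  rfl

theorem norm_expMoment_le {T : ℝ} (hT : 0 < T) {k : ℕ} (y : ℝ) (u : sobolevZero T k) :
    ‖expMoment T k y u‖ ≤ 2 * Real.sqrt T * ‖wderivL T 0 u‖ := by
  have := norm_moment_le hT (continuous_expI y) (M := 1) (fun t _ => (norm_expI y t).le)
    (wderivL T 0 u)
  rwa [mul_one] at this

theorem expMoment_atom {T : ℝ} {k : ℕ} {ρ : ℝ → ℝ} (hρ : IsTest T ρ) (x y : ℝ) (z : ℂ) :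
    expMoment T k y (atom k hρ x z) = 1 / 2 * (z * FT (fun t => (ρ t : ℂ)) (y - x)
      + starRingEnd ℂ z * FT (fun t => (ρ t : ℂ)) (y + x)) := by
  rw [← FT_wave hρ, atom, LinearMap.comp_apply, expMoment_ofTestL]

/-- The ratio `λ_j^m / λ_j^k`. -/
def ratio (lam : ℕ → ℝ) (k m j : ℕ) : ℝ := lam j ^ m / lam j ^ k

theorem ratio_nonneg {lam : ℕ → ℝ} (h : GapSeq 1 lam) (k m j : ℕ) : 0 ≤ ratio lam k m j := by
  have := h.one_le le_rfl j
  unfold ratio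
  positivity

theorem ratio_le_one {lam : ℕ → ℝ} (h : GapSeq 1 lam) {k m : ℕ} (hm : m ≤ k) (j : ℕ) :
    ratio lam k m j ≤ 1 := by
  have h1 := h.one_le le_rfl j
  exact div_le_one_of_le₀ (pow_le_pow_right₀ h1 hm) (by positivity)

theorem norm_ratio_smul_le {lam : ℕ → ℝ} (h : GapSeq 1 lam) {k m : ℕ} (hm : m ≤ k) (j : ℕ)
    (z : ℂ) : ‖ratio lam k m j • z‖ ≤ ‖z‖ := by
  rw [norm_smul, Real.norm_of_nonneg (ratio_nonneg h k m j)]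
  exact mul_le_of_le_one_left (norm_nonneg _) (ratio_le_one h hm j)

theorem summable_ratio_smul {lam : ℕ → ℝ} (h : GapSeq 1 lam) {k m : ℕ} (hm : m ≤ k)
    (x : SeqTwo) : Summable fun j => ‖ratio lam k m j • x j‖ ^ 2 :=
  Summable.of_nonneg_of_le (fun _ => sq_nonneg _)
    (fun j => pow_le_pow_left₀ (norm_nonneg _) (norm_ratio_smul_le h hm j (x j)) 2) x.summable

/-- The sum `∑_j ρ Re (λ_j^{-k} x_j e^{-iλ_jt})` converges in `H^k_0(0,T)`. -/
theorem exists_synthesis {T : ℝ} (hT : 0 < T) (k : ℕ) {ρ : ℝ → ℝ} (hρ : IsTest T ρ) :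
    ∃ C : ℝ, 0 ≤ C ∧ ∀ lam : ℕ → ℝ, GapSeq 1 lam → ∃ A : SeqTwo →ₗ[ℝ] sobolevZero T k,
      ∀ x, HasSum (fun j => atom k hρ (lam j) (ratio lam k 0 j • x j)) (A x) ∧
        ∀ m : Fin (k + 1), ‖wderivL T m (A x)‖
          ≤ C * Real.sqrt (∑' j, ‖ratio lam k m j • x j‖ ^ 2) := by
  choose Cm hCm hb using fun m : Fin (k + 1) => exists_modul_bound hT m hρ
  have hCsum : 0 ≤ ∑ m, Cm m := Finset.sum_nonneg fun m _ => hCm m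
  refine ⟨∑ m, Cm m, hCsum, fun lam hlam => ?_⟩
  have hfin : ∀ (x : SeqTwo) (s : Finset ℕ) (m : Fin (k + 1)),
      ‖wderivL T m (∑ j ∈ s, atom k hρ (lam j) (ratio lam k 0 j • x j))‖
        ≤ Cm m * Real.sqrt (∑ j ∈ s, ‖ratio lam k m j • x j‖ ^ 2) := by
    intro x s m
    rw [sum_atom k hρ lam s (fun j => ratio lam k 0 j • x j), wderivL_apply, wderiv_ofTest]
    refine (hb m lam hlam s _).trans (le_of_eq ?_)
    congr 2
    refine Finset.sum_congr rfl fun j _ => ?_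
    congr 2
    simp [ratio]
    ring
  have hsummable : ∀ x : SeqTwo,
      Summable fun j => atom k hρ (lam j) (ratio lam k 0 j • x j) := by
    intro x
    -- Cauchy criterion: the finite bounds control blocks of the series by blocks of ∑ ‖x_j‖², as
    -- the ratios are at most 1.
    rw [summable_iff_vanishing_norm]
    intro ε hε
    set D := ∑ m, Cm m + 1 with hD
    have hDpos : 0 < D := by positivity
    obtain ⟨s, hs⟩ := summable_iff_vanishing_norm.1 x.summable ((ε / D) ^ 2) (by positivity)
    refine ⟨s, fun t ht => ?_⟩
    have h1 := hs t ht
    rw [Real.norm_of_nonneg (Finset.sum_nonneg fun _ _ => sq_nonneg _)] at h1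
    have h2 : Real.sqrt (∑ j ∈ t, ‖x j‖ ^ 2) < ε / D :=
      (Real.sqrt_lt' (by positivity)).2 h1
    calc _ ≤ ∑ m, ‖wderivL T m (∑ j ∈ t, atom k hρ (lam j) (ratio lam k 0 j • x j))‖ :=
          norm_le_sum_wderiv _
      _ ≤ ∑ m, Cm m * Real.sqrt (∑ j ∈ t, ‖x j‖ ^ 2) := by
          refine Finset.sum_le_sum fun m _ => (hfin x t m).trans ?_
          have := hCm m
          gcongr with j _
          exact norm_ratio_smul_le hlam (Nat.lt_succ_iff.1 m.2) j _
      _ = (∑ m, Cm m) * Real.sqrt (∑ j ∈ t, ‖x j‖ ^ 2) := by rw [Finset.sum_mul]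
      _ ≤ D * Real.sqrt (∑ j ∈ t, ‖x j‖ ^ 2) := by gcongr; linarith
      _ < D * (ε / D) := by gcongr
      _ = ε := by field_simp
  refine ⟨{ toFun := fun x => ∑' j, atom k hρ (lam j) (ratio lam k 0 j • x j)
            map_add' := fun x y => ?_
            map_smul' := fun c x => ?_ }, fun x => ⟨(hsummable x).hasSum, fun m => ?_⟩⟩
  · rw [← (hsummable x).tsum_add (hsummable y)]
    refine tsum_congr fun j => ?_
    rw [← map_add, ← smul_add]
    rfl
  · rw [RingHom.id_apply, ← tsum_const_smul'']
    refine tsum_congr fun j => ?_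
    rw [← map_smul, smul_comm]
    rfl
  · have h1 := ((wderivL T m).continuous.norm.tendsto _).comp (hsummable x).hasSum
    refine le_of_tendsto' h1 fun s => (hfin x s m).trans ?_
    have h2 : Cm m ≤ ∑ m, Cm m := Finset.single_le_sum (fun m _ => hCm m) (Finset.mem_univ m)
    gcongr
    exact (summable_ratio_smul hlam (Nat.lt_succ_iff.1 m.2) x).sum_le_tsum s
      fun _ _ => sq_nonneg _

/-! ### Inverting the Gram matrix -/

/-- The off-diagonal part of the Gram matrix, weighted by `(λ_l / λ_j)^m`. -/
def gramKernel (ρ : ℝ → ℝ) (lam : ℕ → ℝ) (m l j : ℕ) : ℂ →L[ℝ] ℂ :=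
  (lam l ^ m / lam j ^ m) • (
    ((1 / 2 : ℂ) * if j = l then 0 else FT (fun t => (ρ t : ℂ)) (lam l - lam j)) •
      ContinuousLinearMap.id ℝ ℂ
    + ((1 / 2 : ℂ) * FT (fun t => (ρ t : ℂ)) (lam l + lam j)) •
      (Complex.conjCLE : ℂ →L[ℝ] ℂ))

theorem gramKernel_apply (ρ : ℝ → ℝ) (lam : ℕ → ℝ) (m l j : ℕ) (z : ℂ) :
    gramKernel ρ lam m l j z = (lam l ^ m / lam j ^ m) • (1 / 2 *
      ((if j = l then 0 else z * FT (fun t => (ρ t : ℂ)) (lam l - lam j))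
        + starRingEnd ℂ z * FT (fun t => (ρ t : ℂ)) (lam l + lam j))) := by
  simp only [gramKernel, add_apply, smul_apply, ContinuousLinearMap.id_apply,
    ContinuousLinearEquiv.coe_coe, Complex.conjCLE_apply, smul_eq_mul]
  congr 1
  split_ifs <;> ring

/-- Of the k + 2 orders of decay, k absorb the weight p^m ≤ (1+X)^k and two give γ⁻² times the
kernel `decay`. It serves both the differences and the sums of frequencies, with p = λ_l/λ_j. -/
theorem norm_FT_le_decay {A γ x X p : ℝ} {k m : ℕ} {f : ℝ → ℂ} {i : ℤ} (hγ : 0 < γ)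
    (hm : m ≤ k) (hA : (1 + |x|) ^ (k + 2) * ‖FT f x‖ ≤ A) (hX : |x| = X)
    (hXi : γ * (1 + |(i : ℝ)|) / 2 ≤ 1 + X) (hp0 : 0 ≤ p) (hp : p ≤ 1 + X) :
    p ^ m * ‖FT f x‖ ≤ 4 * A / γ ^ 2 * decay i := by
  rw [hX] at hA
  have hX0 : 0 ≤ X := hX ▸ abs_nonneg x
  have h1 : p ^ m ≤ (1 + X) ^ k :=
    (pow_le_pow_left₀ hp0 hp m).trans (pow_le_pow_right₀ (by linarith) hm)
  have h2 : (γ * (1 + |(i : ℝ)|) / 2) ^ 2 ≤ (1 + X) ^ 2 := by gcongr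
  have h3 : p ^ m * ‖FT f x‖ * (γ * (1 + |(i : ℝ)|) / 2) ^ 2 ≤ A := by
    refine le_trans ?_ hA
    calc _ ≤ (1 + X) ^ k * ‖FT f x‖ * (1 + X) ^ 2 := by gcongr
      _ = _ := by ring
  have hpos : 0 < (γ * (1 + |(i : ℝ)|) / 2) ^ 2 := by positivity
  rw [← le_div_iff₀ hpos] at h3
  refine h3.trans (le_of_eq ?_)
  unfold decay
  field_simp
  norm_num

theorem norm_gramKernel_le {A γ : ℝ} {k m : ℕ} (hγ : 1 ≤ γ) (hm : m ≤ k) {ρ : ℝ → ℝ}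
    (hA : ∀ x, (1 + |x|) ^ (k + 2) * ‖FT (fun t => (ρ t : ℂ)) x‖ ≤ A) {lam : ℕ → ℝ}
    (hlam : GapSeq γ lam) (l j : ℕ) :
    ‖gramKernel ρ lam m l j‖ ≤ 4 * A / γ ^ 2 * decay (l - j) := by
  have hA0 : 0 ≤ A := le_trans (by positivity) (hA 0)
  have hl := hlam.one_le hγ l
  have hj := hlam.one_le hγ j
  have hp0 : 0 ≤ lam l / lam j := by positivity
  have hd := decay_pos ((l : ℤ) - j)
  refine ContinuousLinearMap.opNorm_le_bound _ (by positivity) fun z => ?_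
  rw [gramKernel_apply, ← div_pow, norm_smul, norm_mul, norm_pow, Real.norm_of_nonneg hp0]
  have hplus : (lam l / lam j) ^ m * ‖FT (fun t => (ρ t : ℂ)) (lam l + lam j)‖
      ≤ 4 * A / γ ^ 2 * decay (l - j) := by
    have h1 := hlam.le_add (by linarith) l j
    refine norm_FT_le_decay (by linarith) hm (hA _) (abs_of_pos (by linarith)) ?_ hp0 ?_
    · have : 0 ≤ γ * (1 + |(((l : ℤ) - (j : ℤ) : ℤ) : ℝ)|) := by positivity
      linarith
    · rw [div_le_iff₀ (by linarith : 0 < lam j)]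
      nlinarith
  have hminus : (lam l / lam j) ^ m * ‖if j = l then 0 else
      z * FT (fun t => (ρ t : ℂ)) (lam l - lam j)‖ ≤ 4 * A / γ ^ 2 * decay (l - j) * ‖z‖ := by
    split_ifs with hjl
    · simp only [norm_zero, mul_zero]
      positivity
    · rw [norm_mul, mul_left_comm, mul_comm]
      refine mul_le_mul_of_nonneg_right ?_ (norm_nonneg z)
      have h1 := hlam.le_abs_sub l j
      have h2 : (1 : ℝ) ≤ |(((l : ℤ) - (j : ℤ) : ℤ) : ℝ)| := by
        have : (1 : ℤ) ≤ |(l : ℤ) - j| := Int.one_le_abs (by omega)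
        exact_mod_cast this
      refine norm_FT_le_decay (by linarith) hm (hA _) rfl ?_ hp0 ?_
      -- Off the diagonal |l-j| ≥ 1, so γ|l-j| ≥ γ(1+|l-j|)/2; this is the source of the factor 1/2.
      · nlinarith
      -- Since λ_j ≥ 1, λ_l ≤ λ_j + |λ_l - λ_j| ≤ λ_j (1 + |λ_l - λ_j|).
      · rw [div_le_iff₀ (by linarith : 0 < lam j)]
        have h3 := le_abs_self (lam l - lam j)
        nlinarith [abs_nonneg (lam l - lam j)]
  have h4 : ‖starRingEnd ℂ z * FT (fun t => (ρ t : ℂ)) (lam l + lam j)‖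
      = ‖z‖ * ‖FT (fun t => (ρ t : ℂ)) (lam l + lam j)‖ := by
    rw [norm_mul, RCLike.norm_conj]
  have h5 := norm_add_le (if j = l then 0 else
      z * FT (fun t => (ρ t : ℂ)) (lam l - lam j))
      (starRingEnd ℂ z * FT (fun t => (ρ t : ℂ)) (lam l + lam j))
  rw [h4] at h5
  have h6 : ‖(1 / 2 : ℂ)‖ = 1 / 2 := by norm_num
  rw [h6]
  have h7 := mul_le_mul_of_nonneg_left h5 (pow_nonneg hp0 m)
  have h8 := mul_le_mul_of_nonneg_left hplus (norm_nonneg z)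
  nlinarith

/-- The moment problem for frequencies with large gaps. -/
theorem exists_gap_solver {T : ℝ} (hT : 0 < T) (k : ℕ) : ∃ γ : ℝ, 1 ≤ γ ∧ ∃ C : ℝ, 0 ≤ C ∧
    ∀ lam : ℕ → ℝ, GapSeq γ lam → ∃ S : SeqTwo →ₗ[ℝ] sobolevZero T k, ∀ b : SeqTwo,
      (∀ l, expMoment T k (lam l) (S b) = ratio lam k 0 l • b l) ∧
      ∀ m : Fin (k + 1), ‖wderivL T m (S b)‖
        ≤ C * Real.sqrt (∑' j, ‖ratio lam k m j • b j‖ ^ 2) := by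
  obtain ⟨ρ, hρ, hρ2⟩ := exists_test_integral_two hT
  obtain ⟨A, hA, hdec⟩ := exists_FT_decay hρ.ofReal.smooth hρ.ofReal.compact (k + 2)
  obtain ⟨C, hC, hsyn⟩ := exists_synthesis hT k hρ
  have hS := decaySum_pos
  -- As γ ≥ 1, also γ² ≥ 8A · `decaySum`, which makes every weighted kernel operator of norm at most
  -- 1/2.
  set γ := max 1 (8 * A * decaySum) with hγdef
  have hγ : 1 ≤ γ := le_max_left _ _
  have hB : 0 ≤ 4 * A / γ ^ 2 := by positivity
  have hsmall : 4 * A / γ ^ 2 * decaySum ≤ 1 / 2 := by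
    have h1 : 8 * A * decaySum ≤ γ := le_max_right _ _
    rw [div_mul_eq_mul_div, div_le_iff₀ (by positivity)]
    nlinarith
  refine ⟨γ, hγ, 2 * C, by positivity, fun lam hlam => ?_⟩
  have hlam1 : GapSeq 1 lam := hlam.mono_gap hγ
  obtain ⟨syn, hsyn⟩ := hsyn lam hlam1
  have hker := fun m (hm : m ≤ k) => norm_gramKernel_le hγ hm hdec hlam
  obtain ⟨R, hR⟩ := exists_kernel_inverse hB (hker k le_rfl) hsmall
  have hpos : ∀ j, 0 < lam j := fun j => by linarith [hlam1.one_le le_rfl j]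
  refine ⟨syn ∘ₗ R, fun b => ⟨fun l => ?_, fun m => ?_⟩⟩
  -- Apply the moment termwise. Factoring out λ_l^{-k} leaves row l of 1 + E_k, the diagonal 1 being
  -- ρ̂(0)/2.
  · have h1 := (hsyn (R b)).1.mapL (expMoment T k (lam l))
    have h2 := (summable_kernel (hker k le_rfl) (R b) l).hasSum
    have h3 : HasSum (fun j => (if j = l then R b l else 0)) (R b l) := hasSum_ite_eq l _
    have h4 := (h3.add h2).const_smul (ratio lam k 0 l)
    have h5 := congrArg (fun x : SeqTwo => x l) (hR b)
    simp only [lp.coeFn_add, Pi.add_apply, kernelOp_apply] at h5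
    rw [h5] at h4
    rw [show (fun j => expMoment T k (lam l) (atom k hρ (lam j) (ratio lam k 0 j • R b j)))
        = fun j => ratio lam k 0 l • ((if j = l then R b l else 0)
          + gramKernel ρ lam k l j (R b j)) from ?_] at h1
    · exact h1.unique h4
    funext j
    have hl := (hpos l).ne'
    have hj := (hpos j).ne'
    rw [expMoment_atom, gramKernel_apply]
    by_cases hjl : j = l
    · subst hjl
      simp only [ratio, pow_zero, if_true, sub_self, hρ2, Complex.real_smul, map_mul,
        Complex.conj_ofReal, div_self (pow_ne_zero k hj), Complex.ofReal_one]
      ring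
    · simp only [ratio, pow_zero, if_neg hjl, Complex.real_smul, map_mul, Complex.conj_ofReal]
      have hl' : (lam l : ℂ) ≠ 0 := by exact_mod_cast hl
      have hj' : (lam j : ℂ) ≠ 0 := by exact_mod_cast hj
      push_cast
      field_simp
      ring
  · have hm : (m : ℕ) ≤ k := Nat.lt_succ_iff.1 m.2
    let y : SeqTwo := ⟨fun j => ratio lam k m j • R b j,
      memℓp_two_iff.2 (summable_ratio_smul hlam1 hm (R b))⟩
    let g : SeqTwo := ⟨fun j => ratio lam k m j • b j,
      memℓp_two_iff.2 (summable_ratio_smul hlam1 hm b)⟩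
    -- Multiplying row l of the solved equation by λ_l^{m-k} conjugates E_k into E_m, which is
    -- equally small.
    have hy : y + kernelOp hB (hker m hm) y = g := by
      ext l
      have h5 := congrArg (fun x : SeqTwo => x l) (hR b)
      simp only [lp.coeFn_add, Pi.add_apply, kernelOp_apply] at h5 ⊢
      change ratio lam k m l • R b l + ∑' j, gramKernel ρ lam m l j (ratio lam k m j • R b j)
        = ratio lam k m l • b l
      rw [← h5, smul_add, ← tsum_const_smul'']
      congr 1
      refine tsum_congr fun j => ?_
      rw [map_smul, gramKernel_apply, gramKernel_apply, smul_smul, smul_smul]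
      congr 1
      have hl := (hpos l).ne'
      have hj := (hpos j).ne'
      unfold ratio
      field_simp
    have h1 : ‖kernelOp hB (hker m hm) y‖ ≤ 1 / 2 * ‖y‖ :=
      ContinuousLinearMap.le_of_opNorm_le _ ((norm_kernelOp_le hB (hker m hm)).trans hsmall) y
    have h2 : ‖y‖ ≤ ‖g‖ + ‖kernelOp hB (hker m hm) y‖ := by
      rw [← hy]
      exact norm_le_add_norm_add _ _
    have h3 : ‖y‖ ≤ 2 * ‖g‖ := by linarith
    rw [SeqTwo.norm_eq, SeqTwo.norm_eq] at h3
    refine ((hsyn (R b)).2 m).trans ?_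
    rw [mul_comm 2 C, mul_assoc]
    exact mul_le_mul_of_nonneg_left h3 hC

section Convolution

open scoped Convolution Pointwise

/-! ### Test functions with prescribed low frequency moments -/

/-- With F = ρ̂(2μ), the phases 1 and i give moments of modulus |2+F|/2 and |2-F|/2, whose sum is at
least 2. This excludes cancellation by the conjugate wave, even for small μ. -/
theorem exists_norm_FT_wave_ge {T : ℝ} {ρ : ℝ → ℝ} (hρ : IsTest T ρ)
    (hρ2 : FT (fun t => (ρ t : ℂ)) 0 = 2) (μ : ℝ) :
    ∃ z : ℂ, ‖z‖ = 1 ∧ 1 ≤ ‖FT (fun t => ((wave hρ μ z).1 t : ℂ)) μ‖ := by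
  set F := FT (fun t => (ρ t : ℂ)) (μ + μ) with hF
  have h4 : (4 : ℝ) ≤ ‖2 + F‖ + ‖2 - F‖ := by
    have := norm_add_le (2 + F) (2 - F)
    rw [show 2 + F + (2 - F) = 4 by ring] at this
    simpa using this
  have hhalf : ‖(1 / 2 : ℂ)‖ = 1 / 2 := by norm_num
  rcases le_total 2 ‖2 + F‖ with h | h
  · refine ⟨1, by simp, ?_⟩
    rw [FT_wave, sub_self, hρ2, ← hF, map_one, one_mul, one_mul, norm_mul, hhalf]
    linarith
  · refine ⟨Complex.I, by simp, ?_⟩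
    rw [FT_wave, sub_self, hρ2, ← hF, Complex.conj_I, norm_mul, hhalf,
      show Complex.I * 2 + -Complex.I * F = Complex.I * (2 - F) by ring, norm_mul,
      Complex.norm_I]
    linarith

/-- A function whose moments at the frequencies `λ_j` vanish, but not that at a frequency `μ` far
away from them. -/
theorem exists_separating_L2 {T : ℝ} (hT : 0 < T) : ∃ γ : ℝ, 1 ≤ γ ∧ ∀ lam : ℕ → ℝ,
    GapSeq γ lam → ∀ μ : ℝ, 0 ≤ μ → (∀ j : ℕ, γ * (j + 1) ≤ lam j - μ) → ∃ w : L2 T,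
      (∀ j, moment T _ (continuous_expI (lam j)) w = 0) ∧
        moment T _ (continuous_expI μ) w ≠ 0 := by
  -- Order 0 suffices: only an L² bound is needed here, and smoothness is restored later by
  -- convolution.
  obtain ⟨γ₀, hγ₀, C, hC, hsol⟩ := exists_gap_solver hT 0
  obtain ⟨ρ, hρ, hρ2⟩ := exists_test_integral_two hT
  obtain ⟨A, hA, hdec⟩ := exists_FT_decay hρ.ofReal.smooth hρ.ofReal.compact 2
  have hS := decaySum_pos
  -- The wave's moments on the tail are O(1/(γ₀+Q)), so the corrector's moment at μ is at most
  -- Q/(γ₀+Q) < 1, while the wave's own is at least 1.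
  set Q := 2 * Real.sqrt T * (C * (A * (decaySum + 1))) with hQ
  have hQ0 : 0 ≤ Q := by positivity
  have hγQ : 0 < γ₀ + Q := by linarith
  refine ⟨γ₀ + Q, by linarith, fun lam hlam μ hμ hfar => ?_⟩
  obtain ⟨S, hS'⟩ := hsol lam (hlam.mono_gap (by linarith))
  obtain ⟨z, hz, hbig⟩ := exists_norm_FT_wave_ge hρ hρ2 μ
  have hFT : ∀ (j : ℕ) (x : ℝ), (γ₀ + Q) * (j + 1) ≤ x →
      ‖FT (fun t => (ρ t : ℂ)) x‖ ≤ A / (γ₀ + Q) * decay j := by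
    intro j x hx
    have h1 := hdec x
    have hj : (0 : ℝ) ≤ j := j.cast_nonneg
    have h2 : (γ₀ + Q) * (1 + (j : ℝ)) ^ 2 ≤ (1 + |x|) ^ 2 := by
      have h3 : (γ₀ + Q) * (1 + j) ≤ 1 + |x| := by linarith [le_abs_self x]
      calc (γ₀ + Q) * (1 + (j : ℝ)) ^ 2 ≤ ((γ₀ + Q) * (1 + j)) ^ 2 := by
            rw [mul_pow]
            gcongr
            nlinarith
        _ ≤ _ := by gcongr
    have h3 : ‖FT (fun t => (ρ t : ℂ)) x‖ * ((γ₀ + Q) * (1 + (j : ℝ)) ^ 2) ≤ A := by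
      refine le_trans ?_ h1
      rw [mul_comm]
      gcongr
    rw [← le_div_iff₀ (by positivity)] at h3
    refine h3.trans (le_of_eq ?_)
    simp only [decay, Int.cast_natCast, abs_of_nonneg hj]
    field_simp
  set d : ℕ → ℂ := fun j => FT (fun t => ((wave hρ μ z).1 t : ℂ)) (lam j) with hd
  have hdj : ∀ j, ‖d j‖ ≤ A / (γ₀ + Q) * decay j := by
    intro j
    have h1 := hFT j (lam j - μ) (hfar j)
    have h2 := hFT j (lam j + μ) (by linarith [hfar j])
    rw [hd]
    simp only
    rw [FT_wave, norm_mul, show ‖(1 / 2 : ℂ)‖ = 1 / 2 by norm_num]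
    have h3 := norm_add_le (z * FT (fun t => (ρ t : ℂ)) (lam j - μ))
      (starRingEnd ℂ z * FT (fun t => (ρ t : ℂ)) (lam j + μ))
    rw [norm_mul, norm_mul, RCLike.norm_conj, hz] at h3
    linarith
  have hdecay1 : ∀ i, decay i ≤ 1 := fun i => by
    unfold decay
    rw [div_le_one (by positivity)]
    nlinarith [abs_nonneg (i : ℝ)]
  have hdsq : ∀ j, ‖d j‖ ^ 2 ≤ (A / (γ₀ + Q)) ^ 2 * decay j := by
    intro j
    have h0 := decay_pos j
    calc ‖d j‖ ^ 2 ≤ (A / (γ₀ + Q) * decay j) ^ 2 := by gcongr; exact hdj j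
      _ = (A / (γ₀ + Q)) ^ 2 * (decay j * decay j) := by ring
      _ ≤ _ := by
        gcongr
        exact mul_le_of_le_one_right h0.le (hdecay1 j)
  have hdecayN : Summable fun j : ℕ => decay j :=
    summable_decay.comp_injective Nat.cast_injective
  have hdsum : Summable fun j => ‖d j‖ ^ 2 :=
    Summable.of_nonneg_of_le (fun _ => sq_nonneg _) hdsq (hdecayN.mul_left _)
  have hNS : ∑' j : ℕ, decay j ≤ decaySum :=
    tsum_comp_le_tsum_of_inj summable_decay (fun i => (decay_pos i).le) Nat.cast_injective
  -- Adding 1 avoids a square root: S ≤ (S+1)² for S ≥ 0.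
  have hdnorm : Real.sqrt (∑' j, ‖d j‖ ^ 2) ≤ A / (γ₀ + Q) * (decaySum + 1) := by
    refine Real.sqrt_le_iff.2 ⟨by positivity, ?_⟩
    refine (hdsum.tsum_le_tsum hdsq (hdecayN.mul_left _)).trans ?_
    rw [tsum_mul_left, mul_pow]
    gcongr
    nlinarith
  let b : SeqTwo := ⟨d, memℓp_two_iff.2 hdsum⟩
  have hratio : ∀ m j, m = 0 → ratio lam 0 m j = 1 := by rintro m j rfl; simp [ratio]
  obtain ⟨hmom, hbd⟩ := hS' b
  have hmom' : ∀ l, expMoment T 0 (lam l) (S b) = d l := fun l => by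
    rw [hmom l, hratio 0 l rfl, one_smul]
  have hbd0 : ‖wderivL T 0 (S b)‖ ≤ C * Real.sqrt (∑' j, ‖d j‖ ^ 2) := by
    have := hbd 0
    simpa [hratio] using this
  have hsmall : ‖expMoment T 0 μ (S b)‖ < 1 := by
    calc _ ≤ 2 * Real.sqrt T * ‖wderivL T 0 (S b)‖ := norm_expMoment_le hT μ _
      _ ≤ 2 * Real.sqrt T * (C * (A / (γ₀ + Q) * (decaySum + 1))) := by
        gcongr
        exact hbd0.trans (by gcongr)
      _ = Q / (γ₀ + Q) := by rw [hQ]; ring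
      _ < 1 := by rw [div_lt_one hγQ]; linarith
  refine ⟨wderivL T 0 (ofTestL T 0 (wave hρ μ z) - S b), fun j => ?_, fun h0 => ?_⟩
  · change expMoment T 0 (lam j) _ = 0
    rw [map_sub, hmom', expMoment_ofTestL, sub_self]
  · change expMoment T 0 μ _ = 0 at h0
    rw [map_sub, expMoment_ofTestL, sub_eq_zero] at h0
    rw [← h0] at hsmall
    linarith

/-- Because w is real, zeros at the tail frequencies give zeros at their negatives for free. -/
theorem moment_conj {T : ℝ} (w : L2 T) (x : ℝ) :
    moment T _ (continuous_expI (-x)) w = starRingEnd ℂ (moment T _ (continuous_expI x) w) := by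
  rw [moment_apply, moment_apply, ← integral_conj]
  refine integral_congr_ae (ae_of_all _ fun t => ?_)
  simp [← Complex.exp_conj]

/-- The exponential is multiplicative, so smoothing by convolution preserves the zeros of the
transform. -/
theorem FT_convolution {f g : ℝ → ℂ} (hf : Integrable f) (hg : Integrable g) (x : ℝ) :
    FT (f ⋆[ContinuousLinearMap.mul ℝ ℂ] g) x = FT f x * FT g x := by
  have hint : ∀ {f : ℝ → ℂ}, Integrable f →
      Integrable fun t => f t * Complex.exp (Complex.I * x * t) := fun h =>
    h.mul_bdd (c := 1) (continuous_expI x).aestronglyMeasurable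
      (ae_of_all _ fun t => (norm_expI x t).le)
  have key := integral_convolution (ContinuousLinearMap.mul ℝ ℂ) (hint hf) (hint hg)
    (μ := volume) (ν := volume)
  rw [ContinuousLinearMap.mul_apply'] at key
  rw [FT, FT, FT, ← key]
  refine integral_congr_ae (ae_of_all _ fun t => ?_)
  simp only [convolution_def, ContinuousLinearMap.mul_apply']
  rw [← integral_mul_const]
  refine integral_congr_ae (ae_of_all _ fun s => ?_)
  simp only
  rw [show Complex.I * x * t = Complex.I * x * s + Complex.I * x * ((t - s : ℝ) : ℂ) by
    push_cast; ring, Complex.exp_add]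
  ring

/-- As `exists_separating_L2`, with a test function. -/
theorem exists_separating_test {T : ℝ} (hT : 0 < T) : ∃ γ : ℝ, 1 ≤ γ ∧ ∀ lam : ℕ → ℝ,
    GapSeq γ lam → ∀ μ : ℝ, 0 ≤ μ → (∀ j : ℕ, γ * (j + 1) ≤ lam j - μ) → ∃ h : ℝ → ℂ,
      IsCTest T h ∧ (∀ j, FT h (lam j) = 0 ∧ FT h (-lam j) = 0) ∧ FT h μ ≠ 0 := by
  -- Both factors live on half the interval, so that their convolution is supported in (0,T).
  have hT2 : 0 < T / 2 := by positivity
  obtain ⟨γ, hγ, hsep⟩ := exists_separating_L2 hT2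
  refine ⟨γ, hγ, fun lam hlam μ hμ hfar => ?_⟩
  obtain ⟨w, hw0, hwμ⟩ := hsep lam hlam μ hμ hfar
  obtain ⟨ρ, hρ, hρ2⟩ := exists_test_integral_two hT2
  obtain ⟨z, -, hbig⟩ := exists_norm_FT_wave_ge hρ hρ2 μ
  set η : ℝ → ℂ := fun t => ((wave hρ μ z).1 t : ℂ) with hη
  have hηt : IsCTest (T / 2) η := IsTest.ofReal (wave hρ μ z).2
  set f : ℝ → ℂ := (Ioo 0 (T / 2)).indicator fun t => (w t : ℂ) with hf
  have hfi : Integrable f := by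
    rw [hf, integrable_indicator_iff measurableSet_Ioo]
    exact ((Lp.memLp w).integrable (by norm_num)).ofReal
  have hηi : Integrable η := hηt.smooth.continuous.integrable_of_hasCompactSupport hηt.compact
  have hFTf : ∀ x, FT f x = moment (T / 2) _ (continuous_expI x) w := by
    intro x
    rw [moment_apply, FT, ← integral_indicator measurableSet_Ioo]
    refine integral_congr_ae (ae_of_all _ fun t => ?_)
    simp only [hf, indicator]
    split_ifs <;> simp
  have hsub : Function.support (f ⋆[ContinuousLinearMap.mul ℝ ℂ] η)
      ⊆ Icc 0 (T / 2) + tsupport η := by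
    refine (support_convolution_subset _).trans (add_subset_add ?_ (subset_tsupport _))
    exact (support_indicator_subset).trans Ioo_subset_Icc_self
  have hcomp : IsCompact (Icc 0 (T / 2) + tsupport η) := isCompact_Icc.add hηt.compact
  refine ⟨f ⋆[ContinuousLinearMap.mul ℝ ℂ] η, ⟨?_, ?_, ?_⟩, fun j => ⟨?_, ?_⟩, ?_⟩
  · exact hηt.compact.contDiff_convolution_right _ hfi.locallyIntegrable hηt.smooth
  · exact HasCompactSupport.of_support_subset_isCompact hcomp hsub
  · refine (closure_minimal hsub hcomp.isClosed).trans ?_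
    rintro _ ⟨x, hx, y, hy, rfl⟩
    have := hηt.support hy
    exact ⟨by simp only; linarith [hx.1, this.1], by simp only; linarith [hx.2, this.2]⟩
  · rw [FT_convolution hfi hηi, hFTf, hw0, zero_mul]
  · rw [FT_convolution hfi hηi, hFTf, moment_conj, hw0, map_zero, zero_mul]
  · rw [FT_convolution hfi hηi, hFTf]
    refine mul_ne_zero hwμ fun h => ?_
    rw [h, norm_zero] at hbig
    linarith

end Convolution

/-! ### Imposing finitely many conditions on test functions -/

/-- The test functions on `(0,T)` whose Fourier transform vanishes on `Z`. -/
structure IsNullTest (T : ℝ) (Z : Set ℝ) (h : ℝ → ℂ) : Prop where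
  test : IsCTest T h
  zero : ∀ x ∈ Z, FT h x = 0

theorem IsCTest.integrable_mul {T : ℝ} {h ψ : ℝ → ℂ} (hh : IsCTest T h) (hψ : Continuous ψ) :
    Integrable fun t => h t * ψ t :=
  (hh.smooth.continuous.mul hψ).integrable_of_hasCompactSupport hh.compact.mul_right

theorem FT_add {T : ℝ} {g h : ℝ → ℂ} (hg : IsCTest T g) (hh : IsCTest T h) (x : ℝ) :
    FT (g + h) x = FT g x + FT h x := by
  simp only [FT, Pi.add_apply, add_mul]
  exact integral_add (hg.integrable_mul (continuous_expI x)) (hh.integrable_mul (continuous_expI x))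

theorem FT_smul (c : ℂ) (h : ℝ → ℂ) (x : ℝ) : FT (c • h) x = c * FT h x := by
  simp only [FT, Pi.smul_apply, smul_eq_mul, mul_assoc]
  exact integral_const_mul _ _

/-- The moment `∫ h(t) t^p dt`. -/
def powMoment (p : ℕ) (h : ℝ → ℂ) : ℂ := ∫ t, h t * (t : ℂ) ^ p

theorem powMoment_add {T : ℝ} {g h : ℝ → ℂ} (hg : IsCTest T g) (hh : IsCTest T h) (p : ℕ) :
    powMoment p (g + h) = powMoment p g + powMoment p h := by
  simp only [powMoment, Pi.add_apply, add_mul]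
  exact integral_add (hg.integrable_mul (by fun_prop)) (hh.integrable_mul (by fun_prop))

theorem powMoment_smul (c : ℂ) (h : ℝ → ℂ) (p : ℕ) : powMoment p (c • h) = c * powMoment p h := by
  simp only [powMoment, Pi.smul_apply, smul_eq_mul, mul_assoc]
  exact integral_const_mul _ _

theorem powMoment_zero (h : ℝ → ℂ) : powMoment 0 h = FT h 0 := by simp [powMoment, FT]

namespace IsNullTest

variable {T : ℝ} {Z : Set ℝ} {g h : ℝ → ℂ}

theorem add (hg : IsNullTest T Z g) (hh : IsNullTest T Z h) : IsNullTest T Z (g + h) :=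
  ⟨hg.test.add hh.test, fun x hx => by
    rw [FT_add hg.test hh.test, hg.zero x hx, hh.zero x hx, add_zero]⟩

theorem smul (c : ℂ) (hh : IsNullTest T Z h) : IsNullTest T Z (c • h) :=
  ⟨hh.test.smul c, fun x hx => by rw [FT_smul, hh.zero x hx, mul_zero]⟩

theorem deriv (hh : IsNullTest T Z h) : IsNullTest T Z (deriv h) :=
  ⟨hh.test.deriv, fun x hx => by
    rw [FT_deriv hh.test.smooth hh.test.compact, hh.zero x hx, mul_zero]⟩

theorem iterate_deriv (hh : IsNullTest T Z h) (q : ℕ) : IsNullTest T Z (_root_.deriv^[q] h) := by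
  induction q with
  | zero => exact hh
  | succ q ih => rw [Function.iterate_succ_apply']; exact ih.deriv

theorem FT_iterate_deriv (hh : IsNullTest T Z h) (q : ℕ) (x : ℝ) :
    FT (_root_.deriv^[q] h) x = (-(Complex.I * x)) ^ q * FT h x := by
  induction q with
  | zero => simp
  | succ q ih =>
    have hq := (hh.iterate_deriv q).test
    rw [Function.iterate_succ_apply', FT_deriv hq.smooth hq.compact, ih, pow_succ]
    ring

/-- Each integration by parts lowers the exponent by one, so successive derivatives form a
triangular system for the power moments, with diagonal ±q! ĥ(0). -/
theorem powMoment_iterate_deriv (hh : IsNullTest T Z h) (q : ℕ) :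
    (∀ p < q, powMoment p (_root_.deriv^[q] h) = 0) ∧
      powMoment q (_root_.deriv^[q] h) = (-1) ^ q * q.factorial * FT h 0 := by
  induction q with
  | zero => exact ⟨fun p hp => absurd hp (Nat.not_lt_zero p), by simp [powMoment_zero]⟩
  | succ q ih =>
    have hq := (hh.iterate_deriv q).test
    have key : ∀ p, powMoment p (_root_.deriv^[q + 1] h)
        = -(p * powMoment (p - 1) (_root_.deriv^[q] h)) := fun p => by
      rw [Function.iterate_succ_apply']
      exact integral_deriv_mul_pow hq.smooth hq.compact p
    refine ⟨fun p hp => ?_, ?_⟩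
    · rw [key]
      rcases Nat.eq_zero_or_pos p with rfl | hp0
      · simp
      · rw [ih.1 (p - 1) (by omega)]
        simp
    · rw [key, Nat.add_sub_cancel, ih.2, Nat.factorial_succ]
      push_cast
      ring

/-- Finitely many further zeros can be imposed without destroying a non-zero value. -/
theorem exists_zeros (s : Finset ℝ) {μ : ℝ} (hμ : μ ∉ s) (hh : IsNullTest T Z h)
    (h0 : FT h μ ≠ 0) : ∃ g, IsNullTest T (Z ∪ s) g ∧ FT g μ ≠ 0 := by
  induction s using Finset.induction_on with
  | empty => exact ⟨h, by simpa using hh, h0⟩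
  | insert ν s hν ih =>
    obtain ⟨g, hg, hgμ⟩ := ih fun hs => hμ (Finset.mem_insert_of_mem hs)
    -- The operator d/dt + iν multiplies the transform by -i(x-ν): it creates a zero at ν only and
    -- does not enlarge the support.
    have hFT : ∀ x, FT (_root_.deriv g + (Complex.I * ν) • g) x
        = -(Complex.I * (x - ν)) * FT g x := fun x => by
      rw [FT_add hg.deriv.test (hg.smul _).test, FT_smul,
        FT_deriv hg.test.smooth hg.test.compact]
      ring
    refine ⟨_, ⟨(hg.deriv.add (hg.smul (Complex.I * ν))).test, fun x hx => ?_⟩, ?_⟩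
    · rw [hFT]
      rcases hx with hx | hx
      · rw [hg.zero x (Or.inl hx), mul_zero]
      · rcases Finset.mem_insert.1 hx with rfl | hx
        · simp
        · rw [hg.zero x (Or.inr hx), mul_zero]
    · rw [hFT]
      refine mul_ne_zero (neg_ne_zero.2 (mul_ne_zero Complex.I_ne_zero (sub_ne_zero.2 ?_))) hgμ
      intro he
      exact hμ (by rw [Complex.ofReal_inj.1 he]; exact Finset.mem_insert_self _ _)

/-- The power moments of order `< n` can be prescribed. -/
theorem exists_powMoment (hh : IsNullTest T Z h) (h0 : FT h 0 ≠ 0) (a : ℕ → ℂ) (n : ℕ) :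
    ∃ g, IsNullTest T Z g ∧ ∀ p < n, powMoment p g = a p := by
  induction n with
  | zero => exact ⟨h, hh, fun p hp => absurd hp (Nat.not_lt_zero p)⟩
  | succ n ih =>
    obtain ⟨g, hg, hga⟩ := ih
    obtain ⟨hlow, htop⟩ := hh.powMoment_iterate_deriv n
    have hD := hh.iterate_deriv n
    have hne : powMoment n (_root_.deriv^[n] h) ≠ 0 := by
      rw [htop]
      exact mul_ne_zero (mul_ne_zero (by simp) (by exact_mod_cast n.factorial_ne_zero)) h0
    -- The n-th derivative has no moments below n, so adding a multiple fixes the n-th moment and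
    -- keeps the earlier ones.
    refine ⟨g + ((a n - powMoment n g) / powMoment n (_root_.deriv^[n] h)) • _root_.deriv^[n] h,
      hg.add (hD.smul _), fun p hp => ?_⟩
    rw [powMoment_add hg.test (hD.smul _).test, powMoment_smul]
    rcases Nat.lt_succ_iff_lt_or_eq.1 hp with hp | rfl
    · rw [hlow p hp, mul_zero, add_zero, hga p hp]
    · rw [div_mul_cancel₀ _ hne]
      ring

end IsNullTest

/-- Real parts mix the values at x and -x, so zeros must be imposed at both signs. -/
theorem FT_re {T : ℝ} {h : ℝ → ℂ} (hh : IsCTest T h) (x : ℝ) :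
    FT (fun t => ((h t).re : ℂ)) x = 1 / 2 * (FT h x + starRingEnd ℂ (FT h (-x))) := by
  have h2 : starRingEnd ℂ (FT h (-x))
      = ∫ t, starRingEnd ℂ (h t) * Complex.exp (Complex.I * x * t) := by
    rw [FT, ← integral_conj]
    refine integral_congr_ae (ae_of_all _ fun t => ?_)
    simp [← Complex.exp_conj]
  have hi : Integrable fun t => starRingEnd ℂ (h t) * Complex.exp (Complex.I * x * t) :=
    ((Complex.continuous_conj.comp hh.smooth.continuous).mul
      (continuous_expI x)).integrable_of_hasCompactSupport
      ((hh.compact.comp_left (g := starRingEnd ℂ) (map_zero _)).mul_right)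
  rw [h2, FT, FT, ← integral_add (hh.integrable_mul (continuous_expI x)) hi,
    ← integral_const_mul]
  refine integral_congr_ae (ae_of_all _ fun t => ?_)
  simp only
  rw [Complex.re_eq_add_conj]
  ring

theorem integral_pow_mul_re {T : ℝ} {h : ℝ → ℂ} (hh : IsCTest T h) (p : ℕ) :
    ∫ t, t ^ p * (h t).re = (powMoment p h).re := by
  have := integral_re (hh.integrable_mul (ψ := fun t => (t : ℂ) ^ p) (by fun_prop))
  simp only [RCLike.re_eq_complex_re] at this
  rw [powMoment, ← this]
  refine integral_congr_ae (ae_of_all _ fun t => ?_)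
  simp only
  rw [← Complex.ofReal_pow, Complex.re_mul_ofReal, mul_comm]

/-- The real part of `z g`, for a fixed test function `g`. -/
def reMul {T : ℝ} {g : ℝ → ℂ} (hg : IsCTest T g) : ℂ →ₗ[ℝ] testSpace T where
  toFun z := ⟨fun t => ((z • g) t).re, (hg.smul z).re⟩
  map_add' z w := Subtype.ext <| funext fun t => by simp [add_mul]
  map_smul' c z := Subtype.ext <| funext fun t => by simp; ring

/-- The low frequency parts of the solution. -/
theorem exists_low_tests {T : ℝ} (hT : 0 < T) : ∃ γ : ℝ, 1 ≤ γ ∧ ∀ lam : ℕ → ℝ,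
    GapSeq γ lam → ∀ M : Finset ℝ, (∀ μ ∈ M, 0 ≤ μ ∧ ∀ j : ℕ, γ * (j + 1) ≤ lam j - μ) → ∀ n : ℕ,
    (∀ μ ∈ M, 0 < μ → ∃ G : ℂ →ₗ[ℝ] testSpace T, ∀ z,
      FT (fun t => ((G z).1 t : ℂ)) μ = z ∧
      (∀ ν ∈ M, 0 < ν → ν ≠ μ → FT (fun t => ((G z).1 t : ℂ)) ν = 0) ∧
      (∀ j, FT (fun t => ((G z).1 t : ℂ)) (lam j) = 0) ∧
      ∀ p ≤ n, ∫ t, t ^ p * (G z).1 t = 0) ∧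
    (0 ∈ M → ∀ a : ℕ → ℝ, ∃ φ : testSpace T,
      (∀ ν ∈ M, 0 < ν → FT (fun t => (φ.1 t : ℂ)) ν = 0) ∧
      (∀ j, FT (fun t => (φ.1 t : ℂ)) (lam j) = 0) ∧
      ∀ p ≤ n, ∫ t, t ^ p * φ.1 t = a p) := by
  obtain ⟨γ, hγ, hsep⟩ := exists_separating_test hT
  refine ⟨γ, hγ, fun lam hlam M hM n => ?_⟩
  set Z : Set ℝ := {x | ∃ j, x = lam j ∨ x = -lam j} with hZ
  set M' : Finset ℝ := M ∪ M.image Neg.neg with hM'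
  have hsep' : ∀ μ ∈ M, ∃ g, IsNullTest T (Z ∪ (M'.erase μ : Finset ℝ)) g ∧ FT g μ ≠ 0 := by
    intro μ hμ
    obtain ⟨h, ht, hz, hne⟩ := hsep lam hlam μ (hM μ hμ).1 (hM μ hμ).2
    refine IsNullTest.exists_zeros (M'.erase μ) (Finset.notMem_erase μ M') ⟨ht, ?_⟩ hne
    rintro x ⟨j, rfl | rfl⟩
    exacts [(hz j).1, (hz j).2]
  have hmem : ∀ ν ∈ M, ν ∈ M' := fun ν hν => Finset.mem_union_left _ hν
  have hmem' : ∀ ν ∈ M, -ν ∈ M' := fun ν hν =>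
    Finset.mem_union_right _ (Finset.mem_image_of_mem _ hν)
  refine ⟨fun μ hμ hpos => ?_, fun h0 a => ?_⟩
  · obtain ⟨g, hg, hne⟩ := hsep' μ hμ
    -- Differentiating n + 1 times kills the power moments of order at most n, but not the transform
    -- at μ > 0.
    have hgD := hg.iterate_deriv (n + 1)
    have hneD : FT (deriv^[n + 1] g) μ ≠ 0 := by
      rw [hg.FT_iterate_deriv]
      refine mul_ne_zero (pow_ne_zero _ (neg_ne_zero.2 (mul_ne_zero Complex.I_ne_zero ?_))) hne
      exact_mod_cast hpos.ne'
    -- Normalized to 2, because the real part halves the value; the zero at -μ removes the other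
    -- half.
    have hF := hgD.smul (2 / FT (deriv^[n + 1] g) μ)
    have hF2 : FT ((2 / FT (deriv^[n + 1] g) μ) • deriv^[n + 1] g) μ = 2 := by
      rw [FT_smul, div_mul_cancel₀ _ hneD]
    have hFp : ∀ p ≤ n, powMoment p ((2 / FT (deriv^[n + 1] g) μ) • deriv^[n + 1] g) = 0 :=
      fun p hp => by
        rw [powMoment_smul, (hg.powMoment_iterate_deriv (n + 1)).1 p (by omega), mul_zero]
    generalize (2 / FT (deriv^[n + 1] g) μ) • deriv^[n + 1] g = f at hF hF2 hFp
    have hfz : ∀ z x, FT (fun t => ((reMul hF.test z).1 t : ℂ)) x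
        = 1 / 2 * (z * FT f x + starRingEnd ℂ (z * FT f (-x))) := fun z x => by
      have := FT_re (hF.test.smul z) x
      rwa [FT_smul, FT_smul] at this
    refine ⟨reMul hF.test, fun z => ⟨?_, fun ν hν hν0 hνμ => ?_, fun j => ?_, fun p hp => ?_⟩⟩
    · rw [hfz, hF2, hF.zero (-μ) (Or.inr (Finset.mem_coe.2
        (Finset.mem_erase.2 ⟨by linarith, hmem' μ hμ⟩))), mul_zero, map_zero]
      ring
    · rw [hfz, hF.zero ν (Or.inr (Finset.mem_coe.2 (Finset.mem_erase.2 ⟨hνμ, hmem ν hν⟩))),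
        hF.zero (-ν) (Or.inr (Finset.mem_coe.2
          (Finset.mem_erase.2 ⟨by linarith, hmem' ν hν⟩)))]
      simp
    · rw [hfz, hF.zero (lam j) (Or.inl ⟨j, Or.inl rfl⟩),
        hF.zero (-lam j) (Or.inl ⟨j, Or.inr rfl⟩)]
      simp
    · have := integral_pow_mul_re (hF.test.smul z) p
      rw [powMoment_smul, hFp p hp, mul_zero] at this
      exact this
  · obtain ⟨g, hg, hne⟩ := hsep' 0 h0
    obtain ⟨f, hf, hfp⟩ := hg.exists_powMoment hne (fun p => (a p : ℂ)) (n + 1)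
    refine ⟨⟨fun t => (f t).re, hf.test.re⟩, fun ν hν hν0 => ?_, fun j => ?_, fun p hp => ?_⟩
    · refine (FT_re hf.test ν).trans ?_
      rw [hf.zero ν (Or.inr (Finset.mem_coe.2 (Finset.mem_erase.2 ⟨hν0.ne', hmem ν hν⟩))),
        hf.zero (-ν) (Or.inr (Finset.mem_coe.2
          (Finset.mem_erase.2 ⟨by linarith, hmem' ν hν⟩)))]
      simp
    · refine (FT_re hf.test (lam j)).trans ?_
      rw [hf.zero (lam j) (Or.inl ⟨j, Or.inl rfl⟩), hf.zero (-lam j) (Or.inl ⟨j, Or.inr rfl⟩)]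
      simp
    · refine (integral_pow_mul_re hf.test p).trans ?_
      rw [hfp p (by omega), Complex.ofReal_re]

/-! ### Dominated maps -/

/-- `‖f x‖ ≤ C W x` for some constant `C ≥ 0`. -/
def Dominated {X E : Type*} [SeminormedAddCommGroup E] (W : X → ℝ) (f : X → E) : Prop :=
  ∃ C : ℝ, 0 ≤ C ∧ ∀ x, ‖f x‖ ≤ C * W x

namespace Dominated

variable {X E F : Type*} [SeminormedAddCommGroup E] [SeminormedAddCommGroup F]
  {W : X → ℝ} {f g : X → E}

theorem add (hf : Dominated W f) (hg : Dominated W g) : Dominated W fun x => f x + g x := by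
  obtain ⟨C, hC, h⟩ := hf
  obtain ⟨D, hD, h'⟩ := hg
  refine ⟨C + D, by positivity, fun x => (norm_add_le _ _).trans ?_⟩
  rw [add_mul]
  exact add_le_add (h x) (h' x)

theorem sub (hf : Dominated W f) (hg : Dominated W g) : Dominated W fun x => f x - g x := by
  obtain ⟨C, hC, h⟩ := hf
  obtain ⟨D, hD, h'⟩ := hg
  refine ⟨C + D, by positivity, fun x => (norm_sub_le _ _).trans ?_⟩
  rw [add_mul]
  exact add_le_add (h x) (h' x)

theorem sum {ι : Type*} (s : Finset ι) {f : ι → X → E} (hf : ∀ i ∈ s, Dominated W (f i)) :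
    Dominated W fun x => ∑ i ∈ s, f i x := by
  induction s using Finset.cons_induction with
  | empty => exact ⟨0, le_rfl, fun x => by simp⟩
  | cons i s hi ih =>
    simp only [Finset.sum_cons]
    exact (hf i (Finset.mem_cons_self i s)).add
      (ih fun j hj => hf j (Finset.mem_cons_of_mem hj))

theorem comp_bound {Φ : E → F} {K : ℝ} (hK : 0 ≤ K) (hΦ : ∀ y, ‖Φ y‖ ≤ K * ‖y‖)
    (hf : Dominated W f) : Dominated W fun x => Φ (f x) := by
  obtain ⟨C, hC, h⟩ := hf
  refine ⟨K * C, by positivity, fun x => (hΦ _).trans ?_⟩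
  rw [mul_assoc]
  exact mul_le_mul_of_nonneg_left (h x) hK

theorem clm [NormedSpace ℝ E] [NormedSpace ℝ F] (Φ : E →L[ℝ] F) (hf : Dominated W f) :
    Dominated W fun x => Φ (f x) :=
  hf.comp_bound (norm_nonneg Φ) Φ.le_opNorm

end Dominated

/-! ### Power moments on `H^k_0(0,T)` -/

/-- The moment `u ↦ ∫₀ᵀ u(t) t^p dt`. -/
def powL (T : ℝ) (k p : ℕ) : sobolevZero T k →L[ℝ] ℝ :=
  innerSL ℝ (contL2 T (fun t => t ^ p) (continuous_pow p)) ∘L wderivL T 0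

theorem powL_apply {T : ℝ} {k p : ℕ} (u : sobolevZero T k) :
    powL T k p u = ∫ t in Ioo 0 T, toFn u t * t ^ p :=
  (integral_mul_eq_inner (wderivL T 0 u) (continuous_pow p)).symm

theorem powL_ofTestL {T : ℝ} {k : ℕ} (p : ℕ) (φ : testSpace T) :
    powL T k p (ofTestL T k φ) = ∫ t, t ^ p * φ.1 t := by
  have hφ : IsTest T φ.1 := φ.2
  rw [powL_apply, ← setIntegral_mul_test hφ (fun t ht => by rw [ht, mul_zero])]
  refine integral_congr_ae ?_
  filter_upwards [contL2_ae T (continuous_iteratedDeriv_test hφ ((0 : Fin (k + 1)) : ℕ))]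
    with t ht
  change contL2 T (iteratedDeriv ((0 : Fin (k + 1)) : ℕ) φ.1)
    (continuous_iteratedDeriv_test hφ _) t * t ^ p = _
  rw [ht, mul_comm]
  simp

theorem expMoment_zero {T : ℝ} {k : ℕ} (u : sobolevZero T k) :
    expMoment T k 0 u = (powL T k 0 u : ℂ) := by
  rw [expMoment_apply, powL_apply]
  simp only [Complex.ofReal_zero, mul_zero, zero_mul, Complex.exp_zero, mul_one, pow_zero]
  exact integral_complex_ofReal

/-! ### The data -/

/-- Large gaps beyond some index. -/
theorem exists_gapSeq {ω : ℕ → ℝ} (hmono : StrictMono ω) (hzero : ω 0 = 0)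
    (hgap : AsymptGapPoly ω) (γ : ℝ) : ∃ N : ℕ, 1 ≤ N ∧
      GapSeq γ (fun j => ω (N + j)) ∧ ∀ i < N, ∀ j : ℕ, γ * (j + 1) ≤ ω (N + j) - ω i := by
  obtain ⟨ε, hε, N₀, c, hc, h⟩ := hgap
  have ht : Filter.Tendsto (fun j : ℕ => c * (j : ℝ) ^ ε) Filter.atTop Filter.atTop :=
    ((tendsto_rpow_atTop hε).comp tendsto_natCast_atTop_atTop).const_mul_atTop hc
  obtain ⟨N₁, hN₁⟩ := Filter.eventually_atTop.1 (ht.eventually_ge_atTop γ)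
  set P := max N₀ N₁ with hP
  have hg : ∀ j, P ≤ j → γ ≤ ω (j + 1) - ω j := fun j hj =>
    (hN₁ j ((le_max_right _ _).trans hj)).trans (h j ((le_max_left _ _).trans hj))
  have h0 : ∀ i, i ≤ P → ω i ≤ ω P := fun i hi => hmono.monotone hi
  have hP0 : 0 ≤ ω P := hzero ▸ h0 0 (Nat.zero_le _)
  -- Measuring from ω P, the largest low frequency, yields the distances to all of them; hence N = P
  -- + 1.
  have hseq : GapSeq γ (fun j => ω (P + 1 + j) - ω P) := by
    refine ⟨hg P le_rfl, fun j => ?_⟩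
    have := hg (P + 1 + j) (by omega)
    rw [← add_assoc]
    linarith
  refine ⟨P + 1, by omega, ⟨?_, fun j => ?_⟩, fun i hi j => ?_⟩
  · have := hseq.first
    linarith
  · have := hseq.gap j
    linarith
  · have h1 := hseq.lower j
    have h2 := h0 i (by omega)
    linarith

theorem weight_natCast {ω : ℕ → ℝ} {m j : ℕ} (hj : 1 ≤ j) : weight ω m (j : ℤ) = ω j ^ m := by
  have h : (j : ℤ) ≠ 0 := by omega
  simp [weight, freq, show j ≠ 0 by omega]

theorem weight_pos {ω : ℕ → ℝ} (hmono : StrictMono ω) (hzero : ω 0 = 0) (m j : ℕ) :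
    0 < weight ω m (j : ℤ) := by
  rcases Nat.eq_zero_or_pos j with rfl | hj
  · have : (0 : ℝ) ≤ 0 ^ m := pow_nonneg le_rfl m
    simp only [weight, freq, Nat.cast_zero, if_true, le_refl, Int.toNat_zero, hzero]
    linarith
  · rw [weight_natCast hj]
    have : 0 < ω j := hzero ▸ hmono hj
    positivity

theorem weight_neg_ne_zero {ω : ℕ → ℝ} (hmono : StrictMono ω) (hzero : ω 0 = 0) (m i : ℕ) :
    weight ω m (-((i : ℤ) + 1)) ≠ 0 := by
  have h1 : ¬ (0 : ℤ) ≤ -((i : ℤ) + 1) := by omega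
  have h2 : -((i : ℤ) + 1) ≠ 0 := by omega
  have h3 : 0 < ω (i + 1) := hzero ▸ hmono (Nat.succ_pos i)
  have h4 : (- -((i : ℤ) + 1)).toNat = i + 1 := by omega
  simp only [weight, freq, if_neg h1, if_neg h2, zero_add, h4]
  exact pow_ne_zero _ (neg_ne_zero.2 h3.ne')

/-- The `j`-th term as a linear map. -/
def termL (ω : ℕ → ℝ) (k j : ℕ) : HSeq ω k →ₗ[ℝ] ℂ where
  toFun d := d.term j
  map_add' _ _ := rfl
  map_smul' _ _ := rfl

@[simp]
theorem termL_apply (ω : ℕ → ℝ) (k j : ℕ) (d : HSeq ω k) : termL ω k j d = d.term j := rfl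

/-- The shifted weighted sequence. -/
def tailL (ω : ℕ → ℝ) (k N : ℕ) : HSeq ω k →ₗ[ℝ] SeqTwo where
  toFun d := ⟨fun j => weighted ω k d.term (N + j), memℓp_two_iff.2 <|
    (memℓp_two_iff.1 d.2.2.2).comp_injective (i := fun j => N + j) (add_right_injective N)⟩
  map_add' d e := by
    ext j
    exact congrFun (weighted_add ω k d.1 e.1) (N + j)
  map_smul' c d := by
    ext j
    exact congrFun (weighted_smul ω k c d.1) (N + j)

theorem tailL_apply (ω : ℕ → ℝ) (k N : ℕ) (d : HSeq ω k) (j : ℕ) :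
    tailL ω k N d j = weighted ω k d.term (N + j) := rfl

theorem ratio_smul_tailL {ω : ℕ → ℝ} {N : ℕ} (hN : 1 ≤ N) (hpos : ∀ j, ω (N + j) ≠ 0)
    (k m : ℕ) (d : HSeq ω k) (j : ℕ) :
    ratio (fun j => ω (N + j)) k m j • tailL ω k N d j = weighted ω m d.term (N + j) := by
  rw [tailL_apply, weighted, weighted, weight_natCast (by omega), weight_natCast (by omega),
    ratio, Complex.real_smul, ← mul_assoc, ← Complex.ofReal_mul,
    div_mul_cancel₀ _ (pow_ne_zero k (hpos j))]

theorem norm_hseq (ω : ℕ → ℝ) (k : ℕ) (d : HSeq ω k) :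
    ‖d‖ = Real.sqrt (∑' j, ‖weighted ω k d.term j‖ ^ 2) :=
  SeqTwo.norm_eq (HSeq.toLp ω k d)

section DataNorm

variable {ω : ℕ → ℝ} {m n : ℕ} {a : EuclideanSpace ℝ (Fin n)} {d : ℕ → ℂ}

theorem sum_weight_sq_nonneg :
    0 ≤ ∑ i : Fin n, |weight ω m (-(((i : ℕ) : ℤ) + 1)) * a i| ^ 2 :=
  Finset.sum_nonneg fun _ _ => sq_nonneg _

theorem abs_weight_mul_le_dataNorm (i : Fin n) :
    |weight ω m (-(((i : ℕ) : ℤ) + 1)) * a i| ≤ dataNorm ω m a d := by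
  refine Real.le_sqrt_of_sq_le ?_
  have h1 := Finset.single_le_sum
    (f := fun i : Fin n => |weight ω m (-(((i : ℕ) : ℤ) + 1)) * a i| ^ 2)
    (fun _ _ => sq_nonneg _) (Finset.mem_univ i)
  have h2 : 0 ≤ ∑' j, ‖weighted ω m d j‖ ^ 2 := tsum_nonneg fun _ => sq_nonneg _
  simp only at h1
  linarith

theorem sqrt_tsum_le_dataNorm : Real.sqrt (∑' j, ‖weighted ω m d j‖ ^ 2) ≤ dataNorm ω m a d :=
  Real.sqrt_le_sqrt (le_add_of_nonneg_left sum_weight_sq_nonneg)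

theorem norm_weighted_le (hs : Summable fun j => ‖weighted ω m d j‖ ^ 2) (j : ℕ) :
    ‖weighted ω m d j‖ ≤ Real.sqrt (∑' j, ‖weighted ω m d j‖ ^ 2) :=
  Real.le_sqrt_of_sq_le (hs.le_tsum j fun _ _ => sq_nonneg _)

theorem norm_term_le (hmono : StrictMono ω) (hzero : ω 0 = 0)
    (hs : Summable fun j => ‖weighted ω m d j‖ ^ 2) (j : ℕ) :
    ‖d j‖ ≤ (weight ω m (j : ℤ))⁻¹ * Real.sqrt (∑' j, ‖weighted ω m d j‖ ^ 2) := by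
  have hw := weight_pos hmono hzero m j
  have := norm_weighted_le hs j
  rw [weighted, norm_mul, Complex.norm_real, Real.norm_of_nonneg hw.le] at this
  rw [inv_mul_eq_div, le_div_iff₀ hw, mul_comm]
  exact this

theorem sqrt_tsum_shift_le (hs : Summable fun j => ‖weighted ω m d j‖ ^ 2) (N : ℕ) :
    Real.sqrt (∑' j, ‖weighted ω m d (N + j)‖ ^ 2)
      ≤ Real.sqrt (∑' j, ‖weighted ω m d j‖ ^ 2) :=
  Real.sqrt_le_sqrt (tsum_comp_le_tsum_of_inj hs (fun _ => sq_nonneg _)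
    (add_right_injective N))

end DataNorm

/-! ### The solution operator -/

/-- The data of the power moments: `d_0` for `q = 0` and `d_{-q}` for `1 ≤ q ≤ n`. -/
def powData (ω : ℕ → ℝ) (k n q : ℕ) : (EuclideanSpace ℝ (Fin n) × HSeq ω k) →ₗ[ℝ] ℝ :=
  -- The datum d_{-q} is stored at index q - 1. The alternative is meant for q = 0; its value for q
  -- > n never enters the solution operator.
  if h : 1 ≤ q ∧ q - 1 < n then
    (EuclideanSpace.proj (𝕜 := ℝ) (⟨q - 1, h.2⟩ : Fin n)).toLinearMap ∘ₗ LinearMap.fst ℝ _ _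
  else Complex.reCLM.toLinearMap ∘ₗ termL ω k 0 ∘ₗ LinearMap.snd ℝ _ _

theorem powData_zero {ω : ℕ → ℝ} {k n : ℕ} (x : EuclideanSpace ℝ (Fin n) × HSeq ω k) :
    powData ω k n 0 x = (x.2.term 0).re := by
  simp [powData]

theorem powData_succ {ω : ℕ → ℝ} {k n : ℕ} (i : Fin n)
    (x : EuclideanSpace ℝ (Fin n) × HSeq ω k) : powData ω k n (i + 1) x = x.1 i := by
  simp [powData]

theorem dominated_powData {ω : ℕ → ℝ} {k n : ℕ} {W : EuclideanSpace ℝ (Fin n) × HSeq ω k → ℝ}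
    (ha : ∀ i, Dominated W fun x => x.1 i) (hd : ∀ j, Dominated W fun x => x.2.term j) (q : ℕ) :
    Dominated W fun x => powData ω k n q x := by
  by_cases h : 1 ≤ q ∧ q - 1 < n
  · simpa [powData, h] using ha ⟨q - 1, h.2⟩
  · simpa [powData, h] using (hd 0).clm Complex.reCLM

/-- The solution operator obtained from a solution `V` for the high frequencies by correcting the
low frequency and power moments with the test functions `G i` and `φ q`. -/
def correction {T : ℝ} {ω : ℕ → ℝ} {k n : ℕ} (N : ℕ) (V : HSeq ω k →ₗ[ℝ] sobolevZero T k)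
    (G : ℕ → ℂ →ₗ[ℝ] testSpace T) (φ : ℕ → testSpace T) :
    (EuclideanSpace ℝ (Fin n) × HSeq ω k) →ₗ[ℝ] sobolevZero T k :=
  V ∘ₗ LinearMap.snd ℝ _ _
  + ∑ i ∈ Finset.Ico 1 N, ofTestL T k ∘ₗ G i ∘ₗ
      (termL ω k i - (expMoment T k (ω i)).toLinearMap ∘ₗ V) ∘ₗ LinearMap.snd ℝ _ _
  + ∑ q ∈ Finset.range (n + 1), (powData ω k n q
      - (powL T k q).toLinearMap ∘ₗ V ∘ₗ LinearMap.snd ℝ _ _).smulRight (ofTestL T k (φ q))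

section Correction

variable {T : ℝ} {ω : ℕ → ℝ} {k n N : ℕ} {V : HSeq ω k →ₗ[ℝ] sobolevZero T k}
  {G : ℕ → ℂ →ₗ[ℝ] testSpace T} {φ : ℕ → testSpace T}

theorem correction_apply (x : EuclideanSpace ℝ (Fin n) × HSeq ω k) :
    correction N V G φ x = V x.2
      + ∑ i ∈ Finset.Ico 1 N, ofTestL T k (G i (x.2.term i - expMoment T k (ω i) (V x.2)))
      + ∑ q ∈ Finset.range (n + 1),
        (powData ω k n q x - powL T k q (V x.2)) • ofTestL T k (φ q) := by
  simp [correction, LinearMap.sum_apply]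

/-- The corrections have finitely many coefficients, each bounded by one datum and the L² norm of V.
The gauge `W` is free because it is taken both as the norm of the data, for continuity, and as each
`dataNorm`. -/
theorem dominated_correction {W : EuclideanSpace ℝ (Fin n) × HSeq ω k → ℝ} {F : Type*}
    [SeminormedAddCommGroup F] [NormedSpace ℝ F] (Φ : sobolevZero T k →L[ℝ] F)
    (hV : Dominated W fun x => wderivL T 0 (V x.2)) (ha : ∀ i, Dominated W fun x => x.1 i)
    (hd : ∀ j, Dominated W fun x => x.2.term j) (hΦ : Dominated W fun x => Φ (V x.2)) :
    Dominated W fun x => Φ (correction N V G φ x) := by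
  simp only [correction_apply, map_add, map_sum, map_smul]
  refine (hΦ.add (Dominated.sum _ fun i _ => ?_)).add (Dominated.sum _ fun q _ => ?_)
  · have h1 : Dominated W fun x => x.2.term i - expMoment T k (ω i) (V x.2) :=
      (hd i).sub (hV.clm (moment T _ (continuous_expI (ω i))))
    exact h1.clm (Φ.toLinearMap ∘ₗ ofTestL T k ∘ₗ G i).toContinuousLinearMap
  · have h1 : Dominated W fun x => powData ω k n q x - powL T k q (V x.2) :=
      (dominated_powData ha hd q).sub
        (hV.clm (innerSL ℝ (contL2 T (fun t => t ^ q) (continuous_pow q))))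
    exact h1.clm (ContinuousLinearMap.toSpanSingleton ℝ (Φ (ofTestL T k (φ q))))

end Correction

-- The tail solver gives V, whose moments beyond N are already right. Biorthogonality of the
-- correctors lets all other conditions be met independently, and the estimates follow from those of
-- V.
set_option maxHeartbeats 1000000 in
theorem exists_solution {T : ℝ} (hT : 0 < T) (k n : ℕ) {ω : ℕ → ℝ} (hmono : StrictMono ω)
    (hzero : ω 0 = 0) (hgap : AsymptGapPoly ω) :
    ∃ L : (EuclideanSpace ℝ (Fin n) × HSeq ω k) →ₗ[ℝ] sobolevZero T k,
      (∀ x j, expMoment T k (ω j) (L x) = x.2.term j) ∧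
      (∀ x (i : Fin n), powL T k (i + 1) (L x) = x.1 i) ∧
      Dominated (fun x => ‖x‖) L ∧
      ∀ m : Fin (k + 1), Dominated (fun x => dataNorm ω m x.1 x.2.term)
        fun x => wderivL T m (L x) := by
  obtain ⟨γ₁, hγ₁, C, hC, hsol⟩ := exists_gap_solver hT k
  obtain ⟨γ₂, hγ₂, hlow⟩ := exists_low_tests hT
  have hγ : 1 ≤ max γ₁ γ₂ := hγ₁.trans (le_max_left _ _)
  obtain ⟨N, hN, hlam, hfar⟩ := exists_gapSeq hmono hzero hgap (max γ₁ γ₂)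
  set lam : ℕ → ℝ := fun j => ω (N + j) with hlamdef
  have hlam1 : GapSeq 1 lam := hlam.mono_gap hγ
  have hne : ∀ j, ω (N + j) ≠ 0 := fun j => by
    have : 1 ≤ ω (N + j) := hlam1.one_le le_rfl j
    linarith
  have hω : ∀ j, 1 ≤ j → 0 < ω j := fun j hj => hzero ▸ hmono hj
  obtain ⟨S, hS⟩ := hsol lam (hlam.mono_gap (le_max_left _ _))
  set M : Finset ℝ := (Finset.range N).image ω with hM
  have hmemM : ∀ i < N, ω i ∈ M := fun i hi =>
    Finset.mem_image_of_mem _ (Finset.mem_range.2 hi)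
  obtain ⟨hG, hφ⟩ := hlow lam (hlam.mono_gap (le_max_right _ _)) M (by
    intro μ hμ
    obtain ⟨i, hi, rfl⟩ := Finset.mem_image.1 hμ
    refine ⟨hzero ▸ hmono.monotone (Nat.zero_le i), fun j => ?_⟩
    refine le_trans ?_ (hfar i (Finset.mem_range.1 hi) j)
    gcongr
    exact le_max_right _ _) n
  have hG' : ∀ i ∈ Finset.Ico 1 N, ∃ G : ℂ →ₗ[ℝ] testSpace T, ∀ z,
      FT (fun t => ((G z).1 t : ℂ)) (ω i) = z ∧
      (∀ ν ∈ M, 0 < ν → ν ≠ ω i → FT (fun t => ((G z).1 t : ℂ)) ν = 0) ∧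
      (∀ j, FT (fun t => ((G z).1 t : ℂ)) (lam j) = 0) ∧
      ∀ p ≤ n, ∫ t, t ^ p * (G z).1 t = 0 := fun i hi =>
    hG (ω i) (hmemM i (Finset.mem_Ico.1 hi).2) (hω i (Finset.mem_Ico.1 hi).1)
  choose! G hG using hG'
  choose φ hφ0 hφl hφp using fun q : ℕ =>
    -- The φ q are dual to the powers t^p, p ≤ n; the frequency 0 is treated as the power moment of
    -- order 0.
    hφ (by simpa [hzero] using hmemM 0 hN) fun p => if p = q then 1 else 0
  set V : HSeq ω k →ₗ[ℝ] sobolevZero T k := S ∘ₗ tailL ω k N with hVdef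
  have hVmom : ∀ d j, expMoment T k (ω (N + j)) (V d) = d.term (N + j) := fun d j => by
    have h1 := (hS (tailL ω k N d)).1 j
    rw [ratio_smul_tailL hN hne] at h1
    refine h1.trans ?_
    rw [weighted, weight_natCast (by omega), pow_zero, Complex.ofReal_one, one_mul]
  have hVm : ∀ d (m : Fin (k + 1)), ‖wderivL T m (V d)‖
      ≤ C * Real.sqrt (∑' j, ‖weighted ω m d.term (N + j)‖ ^ 2) := fun d m => by
    have h1 := (hS (tailL ω k N d)).2 m
    simp only [hlamdef, ratio_smul_tailL hN hne] at h1
    exact h1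
  have hsummable : ∀ (d : HSeq ω k) (m : ℕ), m ≤ k →
      Summable fun j => ‖weighted ω m d.term j‖ ^ 2 := fun d m hm => by
    have h1 := summable_ratio_smul hlam1 hm (tailL ω k N d)
    simp only [hlamdef, ratio_smul_tailL hN hne] at h1
    rw [← summable_nat_add_iff N]
    simpa only [add_comm] using h1
  -- Beyond N the frequencies are at least 1, so the weights increase with the order. In particular
  -- every weighted norm controls the L² norm of V.
  have htail : ∀ (d : HSeq ω k) (m m' : ℕ), m ≤ m' → m' ≤ k →
      Real.sqrt (∑' j, ‖weighted ω m d.term (N + j)‖ ^ 2)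
        ≤ Real.sqrt (∑' j, ‖weighted ω m' d.term j‖ ^ 2) := fun d m m' hmm hm' => by
    refine le_trans (Real.sqrt_le_sqrt ?_) (sqrt_tsum_shift_le (hsummable d m' hm') N)
    refine Summable.tsum_le_tsum (fun j => ?_)
      ((hsummable d m (hmm.trans hm')).comp_injective (add_right_injective N))
      ((hsummable d m' hm').comp_injective (add_right_injective N))
    have h1 : 1 ≤ ω (N + j) := hlam1.one_le le_rfl j
    rw [weighted, weighted, norm_mul, norm_mul, weight_natCast (by omega),
      weight_natCast (by omega), Complex.norm_real, Complex.norm_real,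
      Real.norm_of_nonneg (by positivity), Real.norm_of_nonneg (by positivity)]
    gcongr
  have hVnorm : ∀ (x : EuclideanSpace ℝ (Fin n) × HSeq ω k) (m : Fin (k + 1)),
      ‖wderivL T m (V x.2)‖ ≤ C * ‖x‖ := fun x m => by
    refine (hVm x.2 m).trans (mul_le_mul_of_nonneg_left ?_ hC)
    refine (htail x.2 m k (Nat.lt_succ_iff.1 m.2) le_rfl).trans ?_
    rw [← norm_hseq]
    exact norm_snd_le x
  have hpow : ∀ (x : EuclideanSpace ℝ (Fin n) × HSeq ω k) (p : ℕ), p ≤ n →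
      powL T k p (correction N V G φ x) = powData ω k n p x := fun x p hp => by
    rw [correction_apply]
    simp only [map_add, map_sum, map_smul, powL_ofTestL]
    rw [Finset.sum_eq_zero fun i hi => (hG i hi _).2.2.2 p hp,
      Finset.sum_eq_single_of_mem p (Finset.mem_range.2 (by omega)) fun q _ hq => by
        rw [hφp q p hp, if_neg hq.symm, smul_zero],
      hφp p p hp, if_pos rfl, smul_eq_mul]
    ring
  refine ⟨correction N V G φ, fun x j => ?_, fun x i => ?_, ?_, fun m => ?_⟩
  · rcases Nat.lt_or_ge j N with hj | hj
    · rcases Nat.eq_zero_or_pos j with rfl | hj0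
      · rw [hzero, expMoment_zero, hpow x 0 (Nat.zero_le n), powData_zero]
        -- Here the reality of d_0 is needed, the moment at frequency 0 of a real function being
        -- real.
        exact Complex.ext (by simp) (by rw [Complex.ofReal_im]; exact x.2.2.2.1.symm)
      · rw [correction_apply]
        simp only [map_add, map_sum, map_smul, expMoment_ofTestL]
        rw [Finset.sum_eq_single_of_mem j (Finset.mem_Ico.2 ⟨hj0, hj⟩) fun i hi hij =>
            (hG i hi _).2.1 (ω j) (hmemM j hj) (hω j hj0) (hmono.injective.ne hij.symm),
          (hG j (Finset.mem_Ico.2 ⟨hj0, hj⟩) _).1, Finset.sum_eq_zero fun q _ => by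
            rw [hφ0 q (ω j) (hmemM j hj) (hω j hj0), smul_zero]]
        ring
    · obtain ⟨i, rfl⟩ := Nat.exists_eq_add_of_le hj
      rw [correction_apply]
      simp only [map_add, map_sum, map_smul, expMoment_ofTestL]
      rw [Finset.sum_eq_zero fun i' hi' => (hG i' hi' _).2.2.1 i,
        Finset.sum_eq_zero fun q _ => by
          rw [show FT (fun t => ((φ q).1 t : ℂ)) (ω (N + i)) = 0 from hφl q i, smul_zero],
        hVmom, add_zero, add_zero]
  · rw [hpow x _ (by omega), powData_succ]
  · have h1 : Dominated (fun x : EuclideanSpace ℝ (Fin n) × HSeq ω k => ‖x‖)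
        fun x => wderivL T 0 (V x.2) := ⟨C, hC, fun x => hVnorm x 0⟩
    have h2 : ∀ i, Dominated (fun x : EuclideanSpace ℝ (Fin n) × HSeq ω k => ‖x‖)
        fun x => x.1 i := fun i => ⟨1, zero_le_one, fun x => by
      rw [one_mul]
      exact (PiLp.norm_apply_le x.1 i).trans (norm_fst_le x)⟩
    have h3 : ∀ j, Dominated (fun x : EuclideanSpace ℝ (Fin n) × HSeq ω k => ‖x‖)
        fun x => x.2.term j := fun j => by
      have hw := (inv_pos.2 (weight_pos hmono hzero k j)).le
      refine ⟨(weight ω k j)⁻¹, hw, fun x => ?_⟩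
      refine (norm_term_le hmono hzero (hsummable x.2 k le_rfl) j).trans ?_
      rw [← norm_hseq]
      exact mul_le_mul_of_nonneg_left (norm_snd_le x) hw
    choose D hD hDb using fun m : Fin (k + 1) => dominated_correction (N := N) (G := G) (φ := φ)
      (wderivL T m) h1 h2 h3 ⟨C, hC, fun x => hVnorm x m⟩
    refine ⟨∑ m, D m, Finset.sum_nonneg fun m _ => hD m, fun x => ?_⟩
    rw [Finset.sum_mul]
    exact (norm_le_sum_wderiv _).trans (Finset.sum_le_sum fun m _ => hDb m x)
  · have hm : (m : ℕ) ≤ k := Nat.lt_succ_iff.1 m.2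
    have h1 : Dominated (fun x : EuclideanSpace ℝ (Fin n) × HSeq ω k =>
        dataNorm ω m x.1 x.2.term) fun x => wderivL T 0 (V x.2) :=
      ⟨C, hC, fun x => (hVm x.2 0).trans (mul_le_mul_of_nonneg_left
        ((htail x.2 0 m (Nat.zero_le _) hm).trans sqrt_tsum_le_dataNorm) hC)⟩
    have h2 : ∀ i, Dominated (fun x : EuclideanSpace ℝ (Fin n) × HSeq ω k =>
        dataNorm ω m x.1 x.2.term) fun x => x.1 i := fun i =>
      ⟨|weight ω m (-(((i : ℕ) : ℤ) + 1))|⁻¹, by positivity, fun x => by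
        have h := abs_weight_mul_le_dataNorm (ω := ω) (m := m) (a := x.1) (d := x.2.term) i
        rwa [inv_mul_eq_div, le_div_iff₀ (abs_pos.2 (weight_neg_ne_zero hmono hzero m i)),
          Real.norm_eq_abs, mul_comm, ← abs_mul]⟩
    have h3 : ∀ j, Dominated (fun x : EuclideanSpace ℝ (Fin n) × HSeq ω k =>
        dataNorm ω m x.1 x.2.term) fun x => x.2.term j := fun j => by
      have hw := (inv_pos.2 (weight_pos hmono hzero m j)).le
      refine ⟨(weight ω m j)⁻¹, hw, fun x => ?_⟩
      exact (norm_term_le hmono hzero (hsummable x.2 m hm) j).trans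
        (mul_le_mul_of_nonneg_left sqrt_tsum_le_dataNorm hw)
    have h4 : Dominated (fun x : EuclideanSpace ℝ (Fin n) × HSeq ω k =>
        dataNorm ω m x.1 x.2.term) fun x => wderivL T m (V x.2) :=
      ⟨C, hC, fun x => (hVm x.2 m).trans (mul_le_mul_of_nonneg_left
        ((htail x.2 m m le_rfl hm).trans sqrt_tsum_le_dataNorm) hC)⟩
    exact dominated_correction (N := N) (G := G) (φ := φ) (wderivL T m) h1 h2 h3 h4

end TrigMoment

end

theorem theorem3p8 (T : ℝ) (hT : 0 < T) (k n : ℕ) (hn : 1 ≤ n) (ω : ℕ → ℝ)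
    (hmono : StrictMono ω) (hzero : ω 0 = 0) (hgap : TrigMoment.AsymptGapPoly ω) :
    ∃ C : ℝ, 0 < C ∧
      ∃ L : (EuclideanSpace ℝ (Fin n) × TrigMoment.HSeq ω k) →L[ℝ] TrigMoment.sobolevZero T k,
        ∀ (a : EuclideanSpace ℝ (Fin n)) (d : TrigMoment.HSeq ω k),
          (∀ j : ℕ,
            ∫ t in Set.Ioo 0 T, ((TrigMoment.toFn (L (a, d)) t : ℝ) : ℂ)
              * Complex.exp (Complex.I * (ω j : ℂ) * (t : ℂ)) = d.term j) ∧
          (∀ i : Fin n,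
            ∫ t in Set.Ioo 0 T, t ^ ((i : ℕ) + 1) * TrigMoment.toFn (L (a, d)) t = a i) ∧
          (∀ m : Fin (k + 1),
            TrigMoment.normZero m (L (a, d)) ≤ C * TrigMoment.dataNorm ω (m : ℕ) a d.term) := by
  obtain ⟨L, hexp, hpow, ⟨B, hB, hLB⟩, hdom⟩ :=
    TrigMoment.exists_solution hT k n hmono hzero hgap
  choose Cm hCm hLm using hdom
  have hsum : 0 ≤ ∑ m, Cm m := Finset.sum_nonneg fun m _ => hCm m
  -- Summing the constants serves all orders at once; adding 1 makes the result positive.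
  refine ⟨∑ m, Cm m + 1, by positivity, L.mkContinuous B hLB, fun a d =>
    ⟨fun j => ?_, fun i => ?_, fun m => ?_⟩⟩
  · exact (TrigMoment.expMoment_apply (ω j) _).symm.trans (hexp (a, d) j)
  · simp only [mul_comm (_ ^ _)]
    exact TrigMoment.powL_apply _ |>.symm.trans (hpow (a, d) i)
  · rw [TrigMoment.normZero_eq]
    refine (hLm m (a, d)).trans ?_
    have h1 : Cm m ≤ ∑ m, Cm m := Finset.single_le_sum (fun m _ => hCm m) (Finset.mem_univ m)
    have h2 : 0 ≤ TrigMoment.dataNorm ω m a d.term := Real.sqrt_nonneg _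
    simp only
    gcongr
    linarith
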